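/- Let $N\ge 2$, let $\kappa$ be transcendental over $\mathbb{Q}$, $\mathbb{F}=\mathbb{Q}(\kappa)$, and let $\tau$ be a partition of $N$. Permutations $w\in\mathcal{S}_N$ act on polynomials by $wp(x)=p(xw)$, $(xw)_i=x_{w(i)}$, and on $\alpha\in\mathbb{N}_0^N$ by $(w\alpha)_i=\alpha_{w^{-1}(i)}$; $s_i=(i,i+1)$. *Tableaux and $V_\tau$.* Let $Y(\tau)$ be the set of reversed standard Young tableaux of shape $\tau$ (fillings of the Ferrers diagram of $\tau$ by $1,\dots,N$, each used once, decreasing along rows and columns). For $T\in Y(\tau)$ let $T(i)$ be the node containing $i$, in row $\mathrm{rw}(i,T)$ and column $\mathrm{cm}(i,T)$, and let $c(i,T)=\mathrm{cm}(i,T)-\mathrm{rw}(i,T)$. $V_\tau$ is the $\mathbb{F}$-vector space with basis $\{v_T:T\in Y(\tau)\}$ and the $\mathcal{S}_N$-action determined, with $b=1/(c(i,T)-c(i+1,T))$, by: $s_iv_T=v_T$ if $i,i+1$ are in the same row of $T$; $s_iv_T=-v_T$ if they are in the same column; otherwise, $s_iT$ being $T$ with $i,i+1$ interchanged, $s_iv_T=bv_T+v_{s_iT}$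 if $b>0$ and $s_iv_T=bv_T+(1-b^2)v_{s_iT}$ if $b<0$. The symmetric bilinear form $\langle\cdot,\cdot\rangle_0$ on $V_\tau$ has $\langle v_T,v_{T'}\rangle_0=0$ for $T\ne T'$ and $$\langle v_T,v_T\rangle_0=\prod_{i<j,\ c(i,T)\le c(j,T)-2}\frac{(c(i,T)-c(j,T))^2-1}{(c(i,T)-c(j,T))^2};$$ it is $\mathcal{S}_N$-invariant. For a subgroup $H\le\mathcal{S}_N$ let $Y(T;H)=\{T'\in Y(\tau): v_{T'}\in\mathrm{span}\{wv_T:w\in H\}\}$. *The standard module.* On $M(\tau)=\mathbb{F}[x_1,\dots,x_N]\otimes V_\tau$, with $w(pu)=(wp)(wu)$, let $$\mathcal{D}_i(pu)=\frac{\partial p}{\partial x_i}u+\kappa\sum_{j\ne i}\frac{p(x)-p(x(i,j))}{x_i-x_j}(i,j)u,\qquad \mathcal{U}_if=\mathcal{D}_i(x_if)-\kappa\sum_{j<i}(i,j)f .$$ Let $\langle\cdot,\cdot\rangle$ be the contravariant form: the symmetric $\mathcal{S}_N$-invariant bilinear form on $M(\tau)$ that extends $\langle\cdot,\cdot\rangle_0$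 and satisfies $\langle x_if,g\rangle=\langle f,\mathcal{D}_ig\rangle$; explicitly, $\langle pu,g\rangle=\langle u,(p(\mathcal{D})g)(0)\rangle_0$. *Jack polynomials.* For $\alpha\in\mathbb{N}_0^N$ let $r(\alpha,i)=\#\{j:\alpha_j>\alpha_i\}+\#\{j\le i:\alpha_j=\alpha_i\}$, let $w_\alpha$ be the inverse of $i\mapsto r(\alpha,i)$, and let $\alpha^+=w_\alpha^{-1}\alpha$, a partition. Write $\alpha\succ\beta$ if $\alpha\ne\beta$ and $\sum_{i\le j}\alpha_i\ge\sum_{i\le j}\beta_i$ for all $j$, and $\alpha\vartriangleright\beta$ if $\sum_i\alpha_i=\sum_i\beta_i$ and either $\alpha^+\succ\beta^+$, or $\alpha^+=\beta^+$ and $\alpha\succ\beta$. Let $\zeta_{\alpha,T}$ be the unique element of $x^\alpha w_\alpha v_T+\sum_{\beta\vartriangleleft\alpha}x^\beta V_\tau$ with $\mathcal{U}_i\zeta_{\alpha,T}=(\alpha_i+1+\kappa c(r(\alpha,i),T))\zeta_{\alpha,T}$ for $1\le i\le N$. *The polynomials $f^s$.* Let $\lambda\in\mathbb{N}_0^N$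 be a partition ($\lambda_1\ge\dots\ge\lambda_N$), $W_\lambda=\{w\in\mathcal{S}_N:w\lambda=\lambda\}$, and let $[a_1,b_1],\dots,[a_n,b_n]$ be the maximal intervals with at least two elements on which $\lambda$ is constant. Let $$P_0(T;a,b)=\prod_{a\le i<j\le b,\ \mathrm{cm}(i,T)<\mathrm{cm}(j,T)}\frac{c(j,T)-c(i,T)}{1+c(j,T)-c(i,T)},$$ $$\mathcal{E}_-(\alpha,T)=\prod_{i<j,\ \alpha_i<\alpha_j}\Bigl(1-\frac{\kappa}{\alpha_j-\alpha_i+\kappa(c(r(\alpha,j),T)-c(r(\alpha,i),T))}\Bigr).$$ Let $\lfloor\lambda,T\rfloor$ be the filling of the diagram of $\tau$ with the entry $\lambda_i$ at the node $T(i)$; it is column-strict if its entries strictly increase down each column. If $\lfloor\lambda,T_0\rfloor$ is column-strict, put $$f^s_{\lambda,T_0}=\sum_{\alpha^+=\lambda}\ \sum_{T\in Y(T_0;W_\lambda)}\ \prod_{j=1}^nP_0(T;a_j,b_j)\,\mathcal{E}_-(\alpha,T)\,\zeta_{\alpha,T}.$$ **Corollary.** Let $\lambda,\mu\in\mathbb{N}_0^N$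 be partitions and $T_1,T_2\in Y(\tau)$ such that $\lfloor\lambda,T_1\rfloor$ and $\lfloor\mu,T_2\rfloor$ are column-strict. If $\lambda\ne\mu$ or $T_2\notin Y(T_1;W_\lambda)$, then $\langle f^s_{\lambda,T_1},f^s_{\mu,T_2}\rangle=0$. -/

import Mathlib

open scoped TensorProduct

noncomputable section

namespace VVJack

/-! The entries `1, …, N` are indexed by `Fin N` (so by `0, …, N - 1`), and the nodes of the Ferrers
diagram are the cells `(row, column)` of a `YoungDiagram`, also counted from `0`; contents
(column minus row) do not depend on this. -/

/-- The field `ℚ(κ)`. -/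
abbrev QK : Type := RatFunc ℚ

/-- The transcendental parameter `κ`. -/
def kappa : QK := RatFunc.X

/-! ### Reversed standard Young tableaux -/

/-- Reversed standard Young tableaux of shape `τ`: the node `T.node i` is the one containing `i`, and
entries decrease in each row and in each column. -/
@[ext]
structure RSYT (N : ℕ) (τ : YoungDiagram) where
  node : Fin N ≃ {c : ℕ × ℕ // c ∈ τ.cells}
  row_decreasing : ∀ i j : Fin N,
    (node i).1.1 = (node j).1.1 → (node i).1.2 < (node j).1.2 → j < i
  col_decreasing : ∀ i j : Fin N,
    (node i).1.2 = (node j).1.2 → (node i).1.1 < (node j).1.1 → j < i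

variable {N : ℕ} {τ : YoungDiagram}

instance : Finite (RSYT N τ) :=
  Finite.of_injective RSYT.node fun _ _ h => RSYT.ext h

instance : Fintype (RSYT N τ) := Fintype.ofFinite _

/-- The row of the node containing `i`. -/
def RSYT.rw (T : RSYT N τ) (i : Fin N) : ℕ := (T.node i).1.1

/-- The column of the node containing `i`. -/
def RSYT.cm (T : RSYT N τ) (i : Fin N) : ℕ := (T.node i).1.2

/-- The content `c(i, T)`. -/
def RSYT.content (T : RSYT N τ) (i : Fin N) : ℤ := (T.cm i : ℤ) - (T.rw i : ℤ)

/-- The indices of the simple reflections: `i : Fin (N - 1)` stands for the pair `i, i + 1`. -/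
def lo (i : Fin (N - 1)) : Fin N := ⟨i.1, by omega⟩

/-- See `lo`. -/
def hi (i : Fin (N - 1)) : Fin N := ⟨i.1 + 1, by omega⟩

/-- The simple reflection `s_i = (i, i + 1)`. -/
def simpleRefl (i : Fin (N - 1)) : Equiv.Perm (Fin N) := Equiv.swap (lo i) (hi i)

theorem simpleRefl_lt (i : Fin (N - 1)) (p q : Fin N) (h : simpleRefl i q < simpleRefl i p)
    (hne : ¬ (simpleRefl i q = lo i ∧ simpleRefl i p = hi i)) : q < p := by
  have key : ∀ x : Fin N, (x = lo i ∧ simpleRefl i x = hi i) ∨ (x = hi i ∧ simpleRefl i x = lo i) ∨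
      (x ≠ lo i ∧ x ≠ hi i ∧ simpleRefl i x = x) := by
    intro x
    by_cases h1 : x = lo i
    · left; exact ⟨h1, by rw [h1]; exact Equiv.swap_apply_left _ _⟩
    · by_cases h2 : x = hi i
      · right; left; exact ⟨h2, by rw [h2]; exact Equiv.swap_apply_right _ _⟩
      · right; right; exact ⟨h1, h2, Equiv.swap_apply_of_ne_of_ne h1 h2⟩
  have hp := key p
  have hq := key q
  simp only [Fin.lt_def, Fin.ext_iff, lo, hi, ne_eq] at *
  omega

/-- The tableau `s_i T` obtained by interchanging the entries `i` and `i + 1`, when these lie neither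
in one row nor in one column. -/
def RSYT.interchange (T : RSYT N τ) (i : Fin (N - 1))
    (h : T.rw (lo i) ≠ T.rw (hi i) ∧ T.cm (lo i) ≠ T.cm (hi i)) : RSYT N τ where
  node := (simpleRefl i).trans T.node
  row_decreasing p q h1 h2 := by
    refine simpleRefl_lt i p q (T.row_decreasing _ _ h1 h2) ?_
    rintro ⟨hq, hp⟩
    simp only [Equiv.trans_apply, hq, hp] at h1
    exact h.1 h1.symm
  col_decreasing p q h1 h2 := by
    refine simpleRefl_lt i p q (T.col_decreasing _ _ h1 h2) ?_
    rintro ⟨hq, hp⟩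
    simp only [Equiv.trans_apply, hq, hp] at h1
    exact h.2 h1.symm

/-! ### The module `V_τ` -/

/-- The vector space `V_τ` with basis `v_T`, `T` a reversed standard Young tableau of shape `τ`. -/
abbrev V (N : ℕ) (τ : YoungDiagram) : Type := RSYT N τ →₀ QK

/-- The basis vector `v_T`. -/
def v (T : RSYT N τ) : V N τ := Finsupp.single T 1

/-- `b_i(T) = 1 / (c(i, T) - c(i + 1, T))`. -/
def b (i : Fin (N - 1)) (T : RSYT N τ) : ℚ :=
  1 / ((T.content (lo i) : ℚ) - (T.content (hi i) : ℚ))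

open Classical in
/-- The vector `s_i v_T`. -/
def simpleVec (i : Fin (N - 1)) (T : RSYT N τ) : V N τ :=
  if h : T.rw (lo i) ≠ T.rw (hi i) ∧ T.cm (lo i) ≠ T.cm (hi i) then
    if 0 < b i T then
      (b i T : QK) • v T + v (T.interchange i h)
    else
      (b i T : QK) • v T + ((1 - b i T ^ 2 : ℚ) : QK) • v (T.interchange i h)
  else if T.rw (lo i) = T.rw (hi i) then v T
  else -v T

/-- The action of `s_i` on `V_τ`. -/
def simpleOp (i : Fin (N - 1)) : Module.End QK (V N τ) :=
  Finsupp.linearCombination QK (simpleVec i)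

theorem exists_word (w : Equiv.Perm (Fin N)) :
    ∃ l : List (Fin (N - 1)), (l.map simpleRefl).prod = w := by
  cases N with
  | zero => exact ⟨[], Subsingleton.elim _ _⟩
  | succ n =>
    have hw : w ∈ Submonoid.closure
        (Set.range fun i : Fin n ↦ Equiv.swap i.castSucc i.succ) := by
      rw [Equiv.Perm.mclosure_swap_castSucc_succ]; trivial
    induction hw using Submonoid.closure_induction with
    | mem x hx =>
      obtain ⟨i, rfl⟩ := hx
      exact ⟨[i], by simp [simpleRefl]; rfl⟩
    | one => exact ⟨[], rfl⟩
    | mul x y _ _ hx hy =>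
      obtain ⟨l, rfl⟩ := hx
      obtain ⟨m, rfl⟩ := hy
      exact ⟨l ++ m, by simp⟩

/-- A word in the simple reflections with product `w`. -/
def word (w : Equiv.Perm (Fin N)) : List (Fin (N - 1)) := (exists_word w).choose

/-- The action of `w ∈ S_N` on `V_τ`: if `w = s_{i_1} ⋯ s_{i_k}`, then `w` acts as the product of the
operators `s_{i_1}, …, s_{i_k}`. (The operators satisfy the relations between the simple
reflections, so the word does not matter.) -/
def act (w : Equiv.Perm (Fin N)) : Module.End QK (V N τ) :=
  ((word w).map simpleOp).prod

open Classical in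
/-- The squared norm of `v_T`. -/
def normSq (T : RSYT N τ) : ℚ :=
  ∏ p : Fin N × Fin N with p.1 < p.2 ∧ T.content p.1 ≤ T.content p.2 - 2,
    (((T.content p.1 : ℚ) - (T.content p.2 : ℚ)) ^ 2 - 1) /
      ((T.content p.1 : ℚ) - (T.content p.2 : ℚ)) ^ 2

/-- The invariant form `⟨·,·⟩₀` on `V_τ`, for which the `v_T` are orthogonal with squared norm
`normSq T`. -/
def form0 : V N τ →ₗ[QK] V N τ →ₗ[QK] QK :=
  Finsupp.linearCombination QK fun T => (normSq T : QK) • Finsupp.lapply T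

/-- `V_T(H)`, the span of the vectors `w v_T`, `w ∈ H`. -/
def VH (T : RSYT N τ) (H : Subgroup (Equiv.Perm (Fin N))) : Submodule QK (V N τ) :=
  Submodule.span QK {u | ∃ w ∈ H, u = act w (v T)}

/-- `Y(T; H)`, the set of the `T'` with `v_{T'} ∈ V_T(H)`. -/
def Y (T : RSYT N τ) (H : Subgroup (Equiv.Perm (Fin N))) : Set (RSYT N τ) :=
  {T' | v T' ∈ VH T H}

/-! ### Dunkl operators -/

/-- The scalar polynomials in `x_1, …, x_N`. -/
abbrev Poly (N : ℕ) : Type := MvPolynomial (Fin N) QK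

/-- The standard module `M(τ)`: polynomials with values in `V_τ`. -/
abbrev M (N : ℕ) (τ : YoungDiagram) : Type := Poly N ⊗[QK] V N τ

/-- The monomial `x^α`. -/
def mono (α : Fin N → ℕ) : Poly N := ∏ i, MvPolynomial.X i ^ α i

theorem dvd_sub_swap (i j : Fin N) (p : Poly N) :
    (MvPolynomial.X i - MvPolynomial.X j : Poly N) ∣
      p - MvPolynomial.rename (Equiv.swap i j) p := by
  induction p using MvPolynomial.induction_on with
  | C a => simp
  | add p q hp hq =>
    have := dvd_add hp hq
    rw [map_add]
    convert this using 1
    ring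
  | mul_X p k hp =>
    have hk : (MvPolynomial.X i - MvPolynomial.X j : Poly N) ∣
        MvPolynomial.X k - MvPolynomial.X (Equiv.swap i j k) := by
      by_cases h1 : k = i
      · subst h1; simp
      · by_cases h2 : k = j
        · subst h2
          rw [Equiv.swap_apply_right]
          exact ⟨-1, by ring⟩
        · simp [Equiv.swap_apply_of_ne_of_ne h1 h2]
    have := dvd_add (Dvd.dvd.mul_right hp (MvPolynomial.X k))
      (Dvd.dvd.mul_left hk (MvPolynomial.rename (Equiv.swap i j) p))
    rw [map_mul, MvPolynomial.rename_X]
    convert this using 1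
    ring

open Classical in
/-- The quotient `(p(x) - p(x(i,j))) / (x_i - x_j)`, for `i ≠ j` (and `0` for `i = j`). -/
def ddFun (i j : Fin N) (p : Poly N) : Poly N :=
  if i = j then 0 else (dvd_sub_swap i j p).choose

theorem X_sub_X_ne_zero {i j : Fin N} (h : i ≠ j) :
    (MvPolynomial.X i - MvPolynomial.X j : Poly N) ≠ 0 :=
  sub_ne_zero.mpr fun e => h (MvPolynomial.X_injective e)

theorem ddFun_spec {i j : Fin N} (h : i ≠ j) (p : Poly N) :
    (MvPolynomial.X i - MvPolynomial.X j) * ddFun i j p =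
      p - MvPolynomial.rename (Equiv.swap i j) p := by
  rw [ddFun, if_neg h]
  exact (dvd_sub_swap i j p).choose_spec.symm

/-- `ddFun` as a linear map. -/
def dividedDiff (i j : Fin N) : Poly N →ₗ[QK] Poly N where
  toFun := ddFun i j
  map_add' p q := by
    by_cases h : i = j
    · simp [ddFun, h]
    · apply mul_left_cancel₀ (X_sub_X_ne_zero h)
      rw [mul_add, ddFun_spec h, ddFun_spec h, ddFun_spec h, map_add]
      ring
  map_smul' c p := by
    by_cases h : i = j
    · simp [ddFun, h]
    · apply mul_left_cancel₀ (X_sub_X_ne_zero h)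
      rw [RingHom.id_apply, mul_smul_comm, ddFun_spec h, ddFun_spec h, map_smul, smul_sub]

/-- The action of `w ∈ S_N` on `M(τ)`: `w (p u) = p(xw) (w u)`, where `(xw)_i = x_{w(i)}`. -/
def actM (w : Equiv.Perm (Fin N)) : Module.End QK (M N τ) :=
  TensorProduct.map (MvPolynomial.rename w : Poly N →ₐ[QK] Poly N).toLinearMap (act w)

/-- Multiplication by `x_i` on `M(τ)`. -/
def mulX (i : Fin N) : Module.End QK (M N τ) :=
  TensorProduct.map (LinearMap.mulLeft QK (MvPolynomial.X i : Poly N)) LinearMap.id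

open Classical in
/-- The Dunkl operator `D_i`. -/
def dunkl (i : Fin N) : Module.End QK (M N τ) :=
  TensorProduct.map (MvPolynomial.pderiv i : Derivation QK (Poly N) (Poly N)).toLinearMap
      LinearMap.id +
    kappa • ∑ j : Fin N with j ≠ i, TensorProduct.map (dividedDiff i j) (act (Equiv.swap i j))

open Classical in
/-- The operator `U_i p = D_i (x_i p) - κ ∑_{j < i} (i, j) p`. -/
def opU (i : Fin N) : Module.End QK (M N τ) :=
  dunkl i * mulX i - kappa • ∑ j : Fin N with j < i, actM (Equiv.swap i j)

/-! ### The contravariant form -/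

/-- `D^α`, the product of the (commuting) operators `D_i ^ α_i`. -/
def dunklMono (α : Fin N → ℕ) : Module.End QK (M N τ) :=
  (List.ofFn fun i => dunkl i ^ α i).prod

/-- `p ↦ p(D)`, the linear map with `x^α ↦ D^α`. -/
def polyDunkl : Poly N →ₗ[QK] Module.End QK (M N τ) :=
  (MvPolynomial.basisMonomials (Fin N) QK).constr QK fun α => dunklMono (α : Fin N → ℕ)

/-- The value at `x = 0` of a polynomial with values in `V_τ`. -/
def evalZero : M N τ →ₗ[QK] V N τ :=
  (TensorProduct.lid QK (V N τ)).toLinearMap ∘ₗ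
    LinearMap.rTensor (V N τ)
      (MvPolynomial.aeval (fun _ : Fin N => (0 : QK)) : Poly N →ₐ[QK] QK).toLinearMap

/-- The contravariant form: `⟨p u, g⟩ = ⟨u, (p(D) g)(0)⟩₀`. It is the bilinear form that
extends `⟨·,·⟩₀`, satisfies `⟨x_i f, g⟩ = ⟨f, D_i g⟩`, and for which constants are orthogonal to
polynomials without constant term. -/
def form : M N τ →ₗ[QK] M N τ →ₗ[QK] QK :=
  TensorProduct.lift <|
    LinearMap.mk₂ QK (fun (p : Poly N) (u : V N τ) => form0 u ∘ₗ evalZero ∘ₗ polyDunkl p)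
      (fun p q u => LinearMap.ext fun g => by simp)
      (fun c p u => LinearMap.ext fun g => by simp)
      (fun p u u' => LinearMap.ext fun g => by simp)
      (fun c p u => LinearMap.ext fun g => by simp)

/-! ### Compositions -/

open Classical in
/-- The rank `r(α, i)`, counted from `0`: the number of `j` with `α_j > α_i`, plus the number of
`j < i` with `α_j = α_i`. -/
def rankNat (α : Fin N → ℕ) (i : Fin N) : ℕ :=
  (Finset.univ.filter fun j => α i < α j).card +
    (Finset.univ.filter fun j => j < i ∧ α j = α i).card

theorem rankNat_lt_rankNat (α : Fin N → ℕ) {i j : Fin N}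
    (h : α j < α i ∨ α i = α j ∧ i < j) : rankNat α i < rankNat α j := by
  classical
  unfold rankNat
  rcases h with h | ⟨h, hij⟩
  · apply Nat.lt_add_right
    rw [← Finset.card_union_of_disjoint]
    · apply Finset.card_lt_card
      refine Finset.ssubset_iff_subset_ne.mpr ⟨?_, fun e => ?_⟩
      · intro k
        simp only [Finset.mem_union, Finset.mem_filter, Finset.mem_univ, true_and]
        omega
      · have : i ∈ Finset.univ.filter fun k => α j < α k := by simpa using h
        rw [← e] at this
        simp at this
    · rw [Finset.disjoint_left]
      intro k
      simp only [Finset.mem_filter, Finset.mem_univ, true_and]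
      omega
  · rw [h]
    apply Nat.add_lt_add_left
    apply Finset.card_lt_card
    refine Finset.ssubset_iff_subset_ne.mpr ⟨?_, fun e => ?_⟩
    · intro k
      simp only [Finset.mem_filter, Finset.mem_univ, true_and]
      exact fun hk => ⟨hk.1.trans hij, hk.2⟩
    · have : i ∈ Finset.univ.filter fun k => k < j ∧ α k = α j := by simp [hij, h]
      rw [← e] at this
      simp at this

theorem rankNat_lt (α : Fin N → ℕ) (i : Fin N) : rankNat α i < N := by
  classical
  unfold rankNat
  rw [← Finset.card_union_of_disjoint]
  · conv_rhs => rw [← Fintype.card_fin N, ← Finset.card_univ]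
    apply Finset.card_lt_card
    refine Finset.ssubset_iff_subset_ne.mpr ⟨Finset.subset_univ _, fun e => ?_⟩
    have := Finset.mem_univ i
    rw [← e] at this
    simp at this
  · rw [Finset.disjoint_left]
    intro k
    simp only [Finset.mem_filter, Finset.mem_univ, true_and]
    omega

theorem rank_injective (α : Fin N → ℕ) :
    Function.Injective fun i => (⟨rankNat α i, rankNat_lt α i⟩ : Fin N) := by
  intro i j h
  simp only [Fin.mk.injEq] at h
  by_contra hij
  rcases lt_trichotomy (α i) (α j) with h1 | h1 | h1
  · exact absurd (rankNat_lt_rankNat α (Or.inl h1)) (by omega)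
  · rcases lt_or_gt_of_ne hij with h2 | h2
    · exact absurd (rankNat_lt_rankNat α (Or.inr ⟨h1, h2⟩)) (by omega)
    · exact absurd (rankNat_lt_rankNat α (Or.inr ⟨h1.symm, h2⟩)) (by omega)
  · exact absurd (rankNat_lt_rankNat α (Or.inl h1)) (by omega)

/-- The rank function `i ↦ r(α, i)` as a permutation. -/
def rank (α : Fin N → ℕ) : Equiv.Perm (Fin N) :=
  Equiv.ofBijective _ (Finite.injective_iff_bijective.mp (rank_injective α))

/-- The permutation `w_α`, inverse to `r(α, ·)`. -/
def wPerm (α : Fin N → ℕ) : Equiv.Perm (Fin N) := (rank α)⁻¹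

/-- The partition `α⁺ = w_α⁻¹ α`, that is `(α⁺)_i = α_{w_α(i)}`. -/
def plus (α : Fin N → ℕ) : Fin N → ℕ := fun i => α (wPerm α i)

open Classical in
/-- `α ≻ β`. -/
def Dominates (α β : Fin N → ℕ) : Prop :=
  α ≠ β ∧ ∀ j : Fin N, ∑ i : Fin N with i ≤ j, β i ≤ ∑ i : Fin N with i ≤ j, α i

/-- `α ▷ β`. -/
def Above (α β : Fin N → ℕ) : Prop :=
  ∑ i, α i = ∑ i, β i ∧
    (Dominates (plus α) (plus β) ∨ plus α = plus β ∧ Dominates α β)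

/-! ### Nonsymmetric Jack polynomials -/

/-- The spectral vector `ξ_i(α, T)`. -/
def xi (α : Fin N → ℕ) (T : RSYT N τ) (i : Fin N) : QK :=
  (α i : QK) + 1 + kappa * (T.content (rank α i) : QK)

/-- The defining properties of `ζ_{α,T}`: it is a simultaneous eigenvector of the `U_i` with
eigenvalues `ξ_i(α, T)`, and equals `x^α w_α v_T` up to a combination of the `x^β u` with
`β ◁ α` and `u ∈ V_τ`. -/
def IsJack (α : Fin N → ℕ) (T : RSYT N τ) (z : M N τ) : Prop :=
  (∀ i, opU i z = xi α T i • z) ∧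
    z - mono α ⊗ₜ[QK] act (wPerm α) (v T) ∈
      Submodule.span QK {m : M N τ | ∃ β u, Above α β ∧ m = mono β ⊗ₜ[QK] u}

open Classical in
/-- The nonsymmetric Jack polynomial `ζ_{α,T}`, the element of `M(τ)` determined by `IsJack`. -/
def zeta (α : Fin N → ℕ) (T : RSYT N τ) : M N τ :=
  if h : ∃ z, IsJack α T z then h.choose else 0

/-! ### The symmetric polynomials `f^s_{λ,T}` -/

/-- `W_λ`, the stabilizer of `λ` for the action `(wλ)_i = λ_{w⁻¹(i)}`. -/
def stab (lam : Fin N → ℕ) : Subgroup (Equiv.Perm (Fin N)) where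
  carrier := {w | ∀ i, lam (w⁻¹ i) = lam i}
  one_mem' i := by simp
  mul_mem' {a c} ha hc i := by
    rw [mul_inv_rev, Equiv.Perm.mul_apply, hc, ha]
  inv_mem' {a} ha i := by
    have := ha (a i)
    rw [show a⁻¹ (a i) = i from a.symm_apply_apply i] at this
    rw [inv_inv, this]

open Classical in
/-- The pairs `(a_j, b_j)` of a partition `λ`: the ends of the maximal intervals, with at least two
elements, on which `λ` is constant; thus `W_λ` is the product of the groups of permutations of
these intervals. -/
def blocks (lam : Fin N → ℕ) : Finset (Fin N × Fin N) :=
  {p | p.1 < p.2 ∧ ∀ i, lam i = lam p.1 ↔ p.1 ≤ i ∧ i ≤ p.2}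

open Classical in
/-- `P₀(T; l, m)` (the product over `l ≤ i < j ≤ m` with `cm(i, T) < cm(j, T)`). -/
def P0 (T : RSYT N τ) (l m : Fin N) : ℚ :=
  ∏ p : Fin N × Fin N with l ≤ p.1 ∧ p.1 < p.2 ∧ p.2 ≤ m ∧ T.cm p.1 < T.cm p.2,
    ((T.content p.2 : ℚ) - (T.content p.1 : ℚ)) /
      (1 + (T.content p.2 : ℚ) - (T.content p.1 : ℚ))

open Classical in
/-- `ℰ_ε(α, T)`, for `ε = ±1`. -/
def calE (ε : QK) (α : Fin N → ℕ) (T : RSYT N τ) : QK :=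
  ∏ p : Fin N × Fin N with p.1 < p.2 ∧ α p.1 < α p.2,
    (1 + ε * kappa / ((α p.2 : QK) - (α p.1 : QK) +
      kappa * ((T.content (rank α p.2) : QK) - (T.content (rank α p.1) : QK))))

theorem finite_plus_eq (lam : Fin N → ℕ) : {α : Fin N → ℕ | plus α = lam}.Finite := by
  refine (Set.finite_range fun w : Equiv.Perm (Fin N) => fun i => lam (w i)).subset ?_
  rintro α rfl
  exact ⟨rank α, by funext i; simp [plus, wPerm]⟩

/-- The compositions `α` with `α⁺ = λ`. -/
def above (lam : Fin N → ℕ) : Finset (Fin N → ℕ) := (finite_plus_eq lam).toFinset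

open Classical in
/-- The polynomial `f^s_{λ,T₀}`, the sum over `α⁺ = λ` and `T ∈ Y(T₀; W_λ)` of
`∏_j P₀(T; a_j, b_j) ℰ₋(α, T) ζ_{α,T}`. -/
def fs (lam : Fin N → ℕ) (T0 : RSYT N τ) : M N τ :=
  ∑ α ∈ above lam, ∑ T : RSYT N τ with T ∈ Y T0 (stab lam),
    (((∏ p ∈ blocks lam, P0 T p.1 p.2 : ℚ) : QK) * calE (-1) α T) • zeta α T

/-- The tableau `⌊λ, T⌋`, with the entry `λ_i` at the node `T(i)`. -/
def floorTableau (lam : Fin N → ℕ) (T : RSYT N τ) (c : {c : ℕ × ℕ // c ∈ τ.cells}) : ℕ :=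
  lam (T.node.symm c)

/-- A filling of the Ferrers diagram is column-strict: its entries strictly increase in each column
(downwards, that is with the row index). -/
def ColumnStrict (S : {c : ℕ × ℕ // c ∈ τ.cells} → ℕ) : Prop :=
  ∀ c c' : {c : ℕ × ℕ // c ∈ τ.cells}, c.1.2 = c'.1.2 → c.1.1 < c'.1.1 → S c < S c'

end VVJack

end

/-!
The operators `U_i` are self-adjoint for the contravariant form, and the joint eigenvalues of
`U_1, …, U_N` separate the labels `(α, T)` of the Jack polynomials; hence
`⟨ζ_{α,T}, ζ_{β,T'}⟩ = 0` unless `(α, T) = (β, T')` (`form_zeta_zeta`). The polynomials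
`f^s_{λ,T₁}` and `f^s_{μ,T₂}` are combinations of Jack polynomials whose labels satisfy `α⁺ = λ`,
`T ∈ Y(T₁; W_λ)` and `α⁺ = μ`, `T ∈ Y(T₂; W_μ)`. These sets of labels are disjoint: clearly so for
`λ ≠ μ`, and for `λ = μ`, `T₂ ∉ Y(T₁; W_λ)` because the sets `Y(·; W_λ)` are the classes of an
equivalence relation (`mem_Y_of_mem_of_mem`).

Everything rests on `V_τ` being a representation. That Young's seminormal operators satisfy the
Coxeter relations is checked on the larger space spanned by all fillings of the diagram, standard or
not (`fillOp_braid`): there a transposition acts by a formula without cases, the coefficients taking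
care of the forbidden interchanges. The Coxeter relations suffice because any two reduced words of a
permutation have the same product (`Reduced.unique`), so that `act` is multiplicative and
independent of the chosen words.

Given that, all properties of the Dunkl operators follow from their commutators with the variables
(`dunkl_mulX`) by induction along multiplication by variables, starting from the constants, which
the Dunkl operators annihilate: equivariance (`actM_dunkl`), commutativity (`dunkl_comm`), and the
adjointness of `D_i` and `x_i` in both arguments of the form (`form_mulX_left`, `form_mulX_right`),
of which the self-adjointness of `U_i` is a consequence (`form_opU`).

The eigenvalues separate the labels because `κ` is transcendental and a reversed standard Young
tableau is determined by its contents (`RSYT.content_injective`). The classes `Y(T; W_λ)` are those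
generated by the interchanges of `i` and `i + 1` with `λ_i = λ_{i+1}`, since these reflections
generate `W_λ` (`exists_word_of_mem_stab`) and the off-diagonal coefficients of the seminormal form
do not vanish where an interchange is possible (`offCoeff_ne_zero`).
-/

noncomputable section

namespace VVJack

variable {N : ℕ} {τ : YoungDiagram}

/-! ### Contents of reversed standard Young tableaux -/

theorem RSYT.ext_rw_cm (T : RSYT N τ) {i j : Fin N} (h1 : T.rw i = T.rw j)
    (h2 : T.cm i = T.cm j) : i = j :=
  T.node.injective (Subtype.ext (Prod.ext h1 h2))

theorem RSYT.exists_entry (T : RSYT N τ) {r c : ℕ} (h : (r, c) ∈ τ.cells) :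
    ∃ k, T.rw k = r ∧ T.cm k = c :=
  ⟨T.node.symm ⟨(r, c), h⟩, by simp [RSYT.rw], by simp [RSYT.cm]⟩

/-- The cells weakly to the north-west of a node of `T` are nodes of `T`. -/
theorem RSYT.exists_entry_of_le (T : RSYT N τ) (j : Fin N) {r c : ℕ} (hr : r ≤ T.rw j)
    (hc : c ≤ T.cm j) : ∃ k, T.rw k = r ∧ T.cm k = c :=
  T.exists_entry (τ.isLowerSet (a := (T.node j).1) (b := (r, c)) ⟨hr, hc⟩ (T.node j).2)

/-- Entries decrease weakly towards the south-east. -/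
theorem RSYT.le_of_northwest (T : RSYT N τ) {i j : Fin N} (hr : T.rw i ≤ T.rw j)
    (hc : T.cm i ≤ T.cm j) : j ≤ i := by
  obtain ⟨k, hk1, hk2⟩ := T.exists_entry_of_le j hr le_rfl
  have h1 : k ≤ i := by
    rcases hc.eq_or_lt with h | h
    · exact (T.ext_rw_cm hk1 (hk2.trans h.symm)).le
    · exact (T.row_decreasing i k hk1.symm (by change T.cm i < T.cm k; omega)).le
  have h2 : j ≤ k := by
    rcases hr.eq_or_lt with h | h
    · exact (T.ext_rw_cm (hk1.trans h) hk2).ge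
    · exact (T.col_decreasing k j hk2 (by change T.rw k < T.rw j; omega)).le
  exact h2.trans h1

/-- If the node of `j` lies strictly south-east of that of `i`, then at least the entry in the row
of `i` and the column of `j` lies between `j` and `i`. -/
theorem RSYT.add_two_le (T : RSYT N τ) {i j : Fin N} (hr : T.rw i < T.rw j)
    (hc : T.cm i < T.cm j) : j.1 + 2 ≤ i.1 := by
  obtain ⟨k, hk1, hk2⟩ := T.exists_entry_of_le j hr.le le_rfl
  have h1 := T.le_of_northwest (i := i) (j := k) (by omega) (by omega)
  have h2 := T.le_of_northwest (i := k) (j := j) (by omega) (by omega)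
  have h3 : k ≠ i := by rintro rfl; omega
  have h4 : k ≠ j := by rintro rfl; omega
  simp only [Fin.le_def, ne_eq, Fin.ext_iff] at *
  omega

/-- Between two nodes of the same diagonal there are at least the two nodes next to the upper
one. -/
theorem RSYT.add_three_le (T : RSYT N τ) {i j : Fin N} (hr : T.rw i < T.rw j)
    (hc : T.cm i < T.cm j) : j.1 + 3 ≤ i.1 := by
  obtain ⟨k, hk1, hk2⟩ := T.exists_entry_of_le j (r := T.rw i + 1) (c := T.cm i) hr hc.le
  obtain ⟨l, hl1, hl2⟩ := T.exists_entry_of_le j (r := T.rw i) (c := T.cm i + 1) hr.le hc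
  have h1 := T.le_of_northwest (i := i) (j := k) (by omega) (by omega)
  have h2 := T.le_of_northwest (i := k) (j := j) (by omega) (by omega)
  have h1' := T.le_of_northwest (i := i) (j := l) (by omega) (by omega)
  have h2' := T.le_of_northwest (i := l) (j := j) (by omega) (by omega)
  have h3 : k ≠ i := by rintro rfl; omega
  have h4 : k ≠ j := by rintro rfl; omega
  have h5 : l ≠ i := by rintro rfl; omega
  have h6 : l ≠ j := by rintro rfl; omega
  have h7 : k ≠ l := by rintro rfl; omega
  simp only [Fin.le_def, ne_eq, Fin.ext_iff] at *
  omega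

theorem RSYT.add_three_le_of_content_eq (T : RSYT N τ) {i j : Fin N} (hij : i < j)
    (h : T.content i = T.content j) : i.1 + 3 ≤ j.1 := by
  unfold RSYT.content at h
  rcases lt_trichotomy (T.rw i) (T.rw j) with h1 | h1 | h1
  · have := T.add_three_le h1 (by omega)
    simp only [Fin.lt_def] at hij
    omega
  · exact absurd (T.ext_rw_cm h1 (by omega)) hij.ne
  · exact T.add_three_le h1 (by omega)

theorem RSYT.content_ne (T : RSYT N τ) {i j : Fin N} (hij : i < j) (h : j.1 < i.1 + 3) :
    T.content i ≠ T.content j := fun e => by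
  have := T.add_three_le_of_content_eq hij e
  omega

theorem lo_lt_hi (i : Fin (N - 1)) : lo i < hi i := Nat.lt_succ_self _

theorem RSYT.content_lo_ne_content_hi (T : RSYT N τ) (i : Fin (N - 1)) :
    T.content (lo i) ≠ T.content (hi i) :=
  T.content_ne (lo_lt_hi i) (by simp [lo, hi])

/-- If `i` and `i + 1` lie in one row, then `i` is the right neighbour of `i + 1`. -/
theorem RSYT.content_of_rw_eq (T : RSYT N τ) (i : Fin (N - 1)) (h : T.rw (lo i) = T.rw (hi i)) :
    T.content (lo i) = T.content (hi i) + 1 := by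
  have hlt : T.cm (hi i) < T.cm (lo i) := by
    by_contra hc
    have := T.le_of_northwest h.le (not_lt.mp hc)
    exact absurd (lo_lt_hi i) (not_lt.mpr this)
  obtain ⟨k, hk1, hk2⟩ := T.exists_entry_of_le (lo i) (r := T.rw (lo i)) (c := T.cm (hi i) + 1)
    le_rfl hlt
  have h1 := T.le_of_northwest (i := hi i) (j := k) (by omega) (by omega)
  have h2 := T.le_of_northwest (i := k) (j := lo i) (by omega) (by omega)
  have h3 : k ≠ hi i := by rintro rfl; omega
  have h4 : k = lo i := by
    simp only [Fin.le_def, ne_eq, Fin.ext_iff, lo, hi] at *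
    omega
  subst h4
  unfold RSYT.content
  omega

/-- If `i` and `i + 1` lie in one column, then `i` is the lower neighbour of `i + 1`. -/
theorem RSYT.content_of_cm_eq (T : RSYT N τ) (i : Fin (N - 1)) (h : T.cm (lo i) = T.cm (hi i)) :
    T.content (hi i) = T.content (lo i) + 1 := by
  have hlt : T.rw (hi i) < T.rw (lo i) := by
    by_contra hc
    have := T.le_of_northwest (not_lt.mp hc) h.le
    exact absurd (lo_lt_hi i) (not_lt.mpr this)
  obtain ⟨k, hk1, hk2⟩ := T.exists_entry_of_le (lo i) (r := T.rw (hi i) + 1) (c := T.cm (lo i))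
    hlt le_rfl
  have h1 := T.le_of_northwest (i := hi i) (j := k) (by omega) (by omega)
  have h2 := T.le_of_northwest (i := k) (j := lo i) (by omega) (by omega)
  have h3 : k ≠ hi i := by rintro rfl; omega
  have h4 : k = lo i := by
    simp only [Fin.le_def, ne_eq, Fin.ext_iff, lo, hi] at *
    omega
  subst h4
  unfold RSYT.content
  omega

theorem RSYT.two_le_abs_content_sub (T : RSYT N τ) (i : Fin (N - 1))
    (h : T.rw (lo i) ≠ T.rw (hi i) ∧ T.cm (lo i) ≠ T.cm (hi i)) :
    2 ≤ |T.content (lo i) - T.content (hi i)| := by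
  by_contra hlt
  rw [not_le, abs_lt] at hlt
  have hne := T.content_lo_ne_content_hi i
  unfold RSYT.content at *
  rcases lt_or_gt_of_ne h.1 with h1 | h1
  · have := T.add_two_le h1 (by omega)
    simp only [lo, hi] at this
    omega
  · have := T.add_two_le h1 (by omega)
    simp only [lo, hi] at this
    omega

/-- A tableau is determined by its contents: if the entries larger than `i` occupy the same nodes in
`T` and `T'`, then `i` occupies in both the first free node of its diagonal. -/
theorem RSYT.content_injective : Function.Injective (RSYT.content : RSYT N τ → Fin N → ℤ) := by
  intro T T' hc
  have main : ∀ i, T.node i = T'.node i := by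
    intro i
    induction i using WellFoundedGT.induction with
    | ind i ih =>
      have step : ∀ S S' : RSYT N τ, (∀ j, i < j → S.node j = S'.node j) →
          S.content i = S'.content i → ¬ S.rw i < S'.rw i := by
        intro S S' hS hcon hlt
        unfold RSYT.content at hcon
        obtain ⟨k, hk1, hk2⟩ := S'.exists_entry_of_le i (r := S.rw i) (c := S.cm i) hlt.le
          (by omega)
        have h1 : k ≠ i := by rintro rfl; omega
        have h2 := S'.le_of_northwest (i := k) (j := i) (by omega) (by omega)
        have h3 := hS k (lt_of_le_of_ne h2 h1.symm)
        refine h1 (S.node.injective (h3.trans (Subtype.ext (Prod.ext hk1 hk2))))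
      have e1 := step T T' (fun j hj => ih j hj) (congrFun hc i)
      have e2 := step T' T (fun j hj => (ih j hj).symm) (congrFun hc i).symm
      have hci := congrFun hc i
      unfold RSYT.content at hci
      have hrw : T.rw i = T'.rw i := by omega
      exact Subtype.ext (Prod.ext hrw (by change T.cm i = T'.cm i; omega))
  exact RSYT.ext (Equiv.ext main)

theorem RSYT.content_interchange (T : RSYT N τ) (i : Fin (N - 1)) (h) (k : Fin N) :
    (T.interchange i h).content k = T.content (simpleRefl i k) := rfl

@[simp] theorem simpleRefl_lo (i : Fin (N - 1)) : simpleRefl i (lo i) = hi i :=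
  Equiv.swap_apply_left _ _

@[simp] theorem simpleRefl_hi (i : Fin (N - 1)) : simpleRefl i (hi i) = lo i :=
  Equiv.swap_apply_right _ _

theorem simpleRefl_mul_self (i : Fin (N - 1)) : simpleRefl i * simpleRefl i = 1 :=
  Equiv.swap_mul_self _ _

theorem RSYT.interchange_ne (T : RSYT N τ) (i : Fin (N - 1)) (h) : T.interchange i h ≠ T := by
  intro e
  have h1 : T.node (simpleRefl i (lo i)) = T.node (lo i) :=
    congrArg (fun S : RSYT N τ => S.node (lo i)) e
  rw [simpleRefl_lo] at h1
  exact (lo_lt_hi i).ne' (T.node.injective h1)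

theorem RSYT.interchange_cond (T : RSYT N τ) (i : Fin (N - 1))
    (h : T.rw (lo i) ≠ T.rw (hi i) ∧ T.cm (lo i) ≠ T.cm (hi i)) :
    (T.interchange i h).rw (lo i) ≠ (T.interchange i h).rw (hi i) ∧
      (T.interchange i h).cm (lo i) ≠ (T.interchange i h).cm (hi i) := by
  have e : ∀ k, (T.interchange i h).node k = T.node (simpleRefl i k) := fun _ => rfl
  unfold RSYT.rw RSYT.cm at *
  rw [e, e, simpleRefl_lo, simpleRefl_hi]
  exact ⟨h.1.symm, h.2.symm⟩

theorem RSYT.interchange_interchange (T : RSYT N τ) (i : Fin (N - 1)) (h h') :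
    (T.interchange i h).interchange i h' = T := by
  refine RSYT.ext (Equiv.ext fun k => ?_)
  change T.node (simpleRefl i (simpleRefl i k)) = T.node k
  rw [← Equiv.Perm.mul_apply, simpleRefl_mul_self, Equiv.Perm.one_apply]

/-! ### Operators satisfying the Coxeter relations -/

/-- `Reduced S w g`: some reduced word `s_{i_1} ⋯ s_{i_k}` for `w` has `g = S i_1 ⋯ S i_k`. Words are
built by appending `s_i` on the right, which is allowed only where it creates a descent. -/
inductive Reduced {G : Type*} [Monoid G] (S : Fin (N - 1) → G) : Equiv.Perm (Fin N) → G → Prop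
  | one : Reduced S 1 1
  | step {w : Equiv.Perm (Fin N)} {g : G} (i : Fin (N - 1)) :
      w (lo i) < w (hi i) → Reduced S w g → Reduced S (w * simpleRefl i) (g * S i)

/-- A potential on permutations that drops when a descent is removed. -/
def potential (w : Equiv.Perm (Fin N)) : ℕ := ∑ i : Fin N, (N - i.1) * (w i).1

theorem potential_lt (w : Equiv.Perm (Fin N)) (i : Fin (N - 1)) (h : w (lo i) < w (hi i)) :
    potential w < potential (w * simpleRefl i) := by
  unfold potential
  have hne : lo i ≠ hi i := (lo_lt_hi i).ne
  have hsplit : ∀ f : Fin N → ℕ, ∑ k, f k =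
      f (lo i) + f (hi i) + ∑ k ∈ (Finset.univ.erase (lo i)).erase (hi i), f k := by
    intro f
    rw [← Finset.add_sum_erase _ f (Finset.mem_univ (lo i)), add_assoc,
      Finset.add_sum_erase _ f (Finset.mem_erase.mpr ⟨hne.symm, Finset.mem_univ _⟩)]
  rw [hsplit, hsplit (fun k => (N - k.1) * ((w * simpleRefl i) k).1)]
  have hrest : ∑ k ∈ (Finset.univ.erase (lo i)).erase (hi i), (N - k.1) * (w k).1 =
      ∑ k ∈ (Finset.univ.erase (lo i)).erase (hi i), (N - k.1) * ((w * simpleRefl i) k).1 := by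
    refine Finset.sum_congr rfl fun k hk => ?_
    simp only [Finset.mem_erase] at hk
    rw [Equiv.Perm.mul_apply, simpleRefl, Equiv.swap_apply_of_ne_of_ne hk.2.1 hk.1]
  rw [hrest]
  simp only [Equiv.Perm.mul_apply, simpleRefl_lo, simpleRefl_hi]
  have hN : N - (lo i).1 = (N - (hi i).1) + 1 := by
    have := (hi i).2
    simp only [lo, hi] at *
    omega
  rw [hN]
  simp only [Fin.lt_def] at h
  nlinarith

theorem exists_descent {w : Equiv.Perm (Fin N)} (hw : w ≠ 1) :
    ∃ i : Fin (N - 1), w (hi i) < w (lo i) := by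
  by_contra! hno
  apply hw
  cases N with
  | zero => exact Subsingleton.elim _ _
  | succ n =>
    have hmono : StrictMono w := Fin.strictMono_iff_lt_succ.mpr fun i =>
      lt_of_le_of_ne (hno i) fun e => (lo_lt_hi (N := n + 1) i).ne (w.injective e)
    refine Equiv.ext fun k => ?_
    have := Subsingleton.elim (hmono.orderIsoOfSurjective w w.surjective) (OrderIso.refl _)
    exact congrArg (fun e : Fin (n + 1) ≃o Fin (n + 1) => e k) this

section Coxeter

variable {G : Type*} [Monoid G] {S : Fin (N - 1) → G}

theorem exists_reduced (S : Fin (N - 1) → G) (w : Equiv.Perm (Fin N)) : ∃ g, Reduced S w g := by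
  induction hn : potential w using Nat.strong_induction_on generalizing w with
  | _ n ih =>
    by_cases hw : w = 1
    · exact ⟨1, hw ▸ Reduced.one⟩
    · obtain ⟨i, hi⟩ := exists_descent hw
      have hasc : (w * simpleRefl i) (lo i) < (w * simpleRefl i) (VVJack.hi i) := by
        simpa [Equiv.Perm.mul_apply] using hi
      have hback : w * simpleRefl i * simpleRefl i = w := by
        rw [mul_assoc, simpleRefl_mul_self, mul_one]
      have hlt := potential_lt _ i hasc
      rw [hback] at hlt
      obtain ⟨g, hg⟩ := ih _ (hn ▸ hlt) (w * simpleRefl i) rfl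
      exact ⟨g * S i, hback ▸ Reduced.step i hasc hg⟩

theorem simpleRefl_of_ne {i : Fin (N - 1)} {k : Fin N} (h1 : k.1 ≠ i.1) (h2 : k.1 ≠ i.1 + 1) :
    simpleRefl i k = k :=
  Equiv.swap_apply_of_ne_of_ne (fun e => h1 (congrArg Fin.val e)) fun e => h2 (congrArg Fin.val e)

theorem simpleRefl_braid {i j : Fin (N - 1)} (h : j.1 = i.1 + 1) :
    simpleRefl i * simpleRefl j * simpleRefl i = simpleRefl j * simpleRefl i * simpleRefl j := by
  have e : lo j = hi i := Fin.ext h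
  have h1 : lo i ≠ hi i := (lo_lt_hi i).ne
  have h2 : hi j ≠ hi i := (e ▸ lo_lt_hi j).ne'
  have h3 : lo i ≠ hi j := ((lo_lt_hi i).trans (e ▸ lo_lt_hi j)).ne
  have e1 := Equiv.swap_mul_swap_mul_swap h1 h3
  have e2 := Equiv.swap_mul_swap_mul_swap h2 h3.symm
  unfold simpleRefl
  rw [e, e1, Equiv.swap_comm (lo i) (hi i), Equiv.swap_comm (hi i) (hi j), e2, Equiv.swap_comm]

theorem simpleRefl_comm {i j : Fin (N - 1)} (h : i.1 + 1 < j.1) :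
    simpleRefl i * simpleRefl j = simpleRefl j * simpleRefl i := by
  refine (Equiv.Perm.Disjoint.commute fun k => ?_).eq
  by_cases h1 : k.1 = i.1 ∨ k.1 = i.1 + 1
  · exact Or.inr (simpleRefl_of_ne (by omega) (by omega))
  · exact Or.inl (simpleRefl_of_ne (by omega) (by omega))

theorem Reduced.of_descent {w : Equiv.Perm (Fin N)} {g : G} {i : Fin (N - 1)}
    (hi : w (hi i) < w (lo i)) (h : Reduced S (w * simpleRefl i) g) : Reduced S w (g * S i) := by
  have hback : w * simpleRefl i * simpleRefl i = w := by
    rw [mul_assoc, simpleRefl_mul_self, mul_one]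
  rw [← hback]
  exact Reduced.step i (by simpa [Equiv.Perm.mul_apply] using hi) h

theorem Reduced.eq_one_or {w : Equiv.Perm (Fin N)} {g : G} (h : Reduced S w g) :
    (w = 1 ∧ g = 1) ∨ ∃ i g', w (hi i) < w (lo i) ∧ Reduced S (w * simpleRefl i) g' ∧
      g = g' * S i := by
  cases h with
  | one => exact Or.inl ⟨rfl, rfl⟩
  | @step w' g' i hasc h' =>
    refine Or.inr ⟨i, g', by simpa [Equiv.Perm.mul_apply] using hasc, ?_, rfl⟩
    rwa [mul_assoc, simpleRefl_mul_self, mul_one]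

theorem potential_mul_lt {w : Equiv.Perm (Fin N)} {i : Fin (N - 1)} (h : w (hi i) < w (lo i)) :
    potential (w * simpleRefl i) < potential w := by
  have := potential_lt (w * simpleRefl i) i (by simpa [Equiv.Perm.mul_apply] using h)
  rwa [mul_assoc, simpleRefl_mul_self, mul_one] at this

/-- All reduced words for `w` have the same product: two words ending in different letters `s_i`,
`s_j` are compared with a word for the shortest element of the coset `w ⟨s_i, s_j⟩`. -/
theorem Reduced.unique
    (hbraid : ∀ i j : Fin (N - 1), j.1 = i.1 + 1 → S i * S j * S i = S j * S i * S j)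
    (hcomm : ∀ i j : Fin (N - 1), i.1 + 1 < j.1 → S i * S j = S j * S i)
    {w : Equiv.Perm (Fin N)} {g g' : G} (h : Reduced S w g) (h' : Reduced S w g') : g = g' := by
  induction hn : potential w using Nat.strong_induction_on generalizing w g g' with
  | _ n ih =>
    rcases h.eq_one_or with ⟨hw, hg⟩ | ⟨i, g₁, hi, h₁, hg⟩
    · rcases h'.eq_one_or with ⟨-, hg'⟩ | ⟨j, g₂, hj, -, -⟩
      · rw [hg, hg']
      · rw [hw] at hj
        exact absurd hj (lo_lt_hi j).not_gt
    · rcases h'.eq_one_or with ⟨hw, -⟩ | ⟨j, g₂, hj, h₂, hg'⟩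
      · rw [hw] at hi
        exact absurd hi (lo_lt_hi i).not_gt
      rw [hg, hg']
      clear hg hg' h h' g g'
      have aux : ∀ i j : Fin (N - 1), i.1 < j.1 → w (VVJack.hi i) < w (lo i) →
          w (VVJack.hi j) < w (lo j) → ∀ g₁ g₂, Reduced S (w * simpleRefl i) g₁ →
          Reduced S (w * simpleRefl j) g₂ → g₁ * S i = g₂ * S j := by
        intro i j hij hi hj g₁ g₂ h₁ h₂
        have pi := potential_mul_lt hi
        have pj := potential_mul_lt hj
        have f1 : simpleRefl j (lo i) = lo i :=
          simpleRefl_of_ne (by simp only [lo]; omega) (by simp only [lo]; omega)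
        have f2 : simpleRefl i (VVJack.hi j) = VVJack.hi j :=
          simpleRefl_of_ne (by simp only [VVJack.hi]; omega) (by simp only [VVJack.hi]; omega)
        by_cases hadj : j.1 = i.1 + 1
        · have e : lo j = VVJack.hi i := Fin.ext hadj
          have f3 : simpleRefl j (VVJack.hi i) = VVJack.hi j := by rw [← e, simpleRefl_lo]
          have f4 : simpleRefl i (lo j) = lo i := by rw [e, simpleRefl_hi]
          obtain ⟨u, hu⟩ := exists_reduced S (w * simpleRefl i * simpleRefl j * simpleRefl i)
          have hu' : Reduced S (w * simpleRefl j * simpleRefl i * simpleRefl j) u := by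
            have := simpleRefl_braid hadj
            simp only [mul_assoc] at this hu ⊢
            rwa [← this]
          have r1 : Reduced S (w * simpleRefl i) (u * S i * S j) := by
            refine Reduced.of_descent ?_ (Reduced.of_descent ?_ hu)
            · simp only [Equiv.Perm.mul_apply, f2, f4]
              exact hj.trans (e ▸ hi)
            · simp only [Equiv.Perm.mul_apply, f1, f2, f3, simpleRefl_lo]
              rwa [← e]
          have r2 : Reduced S (w * simpleRefl j) (u * S j * S i) := by
            refine Reduced.of_descent ?_ (Reduced.of_descent ?_ hu')
            · simp only [Equiv.Perm.mul_apply, f1, f3]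
              exact hj.trans (e ▸ hi)
            · simp only [Equiv.Perm.mul_apply, f1, f2, f4, simpleRefl_hi]
              rwa [e]
          rw [ih _ (hn ▸ pi) h₁ r1 rfl, ih _ (hn ▸ pj) h₂ r2 rfl, mul_assoc, mul_assoc,
            mul_assoc, mul_assoc]
          have := hbraid i j hadj
          simp only [mul_assoc] at this
          rw [this]
        · have f3 : simpleRefl j (VVJack.hi i) = VVJack.hi i :=
            simpleRefl_of_ne (by simp only [VVJack.hi]; omega) (by simp only [VVJack.hi]; omega)
          have f4 : simpleRefl i (lo j) = lo j :=
            simpleRefl_of_ne (by simp only [lo]; omega) (by simp only [lo]; omega)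
          obtain ⟨u, hu⟩ := exists_reduced S (w * simpleRefl i * simpleRefl j)
          have hu' : Reduced S (w * simpleRefl j * simpleRefl i) u := by
            rwa [mul_assoc, ← simpleRefl_comm (by omega), ← mul_assoc]
          have r1 : Reduced S (w * simpleRefl i) (u * S j) :=
            Reduced.of_descent (by simpa only [Equiv.Perm.mul_apply, f2, f4] using hj) hu
          have r2 : Reduced S (w * simpleRefl j) (u * S i) :=
            Reduced.of_descent (by simpa only [Equiv.Perm.mul_apply, f1, f3] using hi) hu'
          rw [ih _ (hn ▸ pi) h₁ r1 rfl, ih _ (hn ▸ pj) h₂ r2 rfl, mul_assoc, mul_assoc,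
            hcomm i j (by omega)]
      rcases lt_trichotomy i.1 j.1 with hij | hij | hij
      · exact aux i j hij hi hj g₁ g₂ h₁ h₂
      · obtain rfl := Fin.ext hij
        rw [ih _ (hn ▸ potential_mul_lt hi) h₁ h₂ rfl]
      · exact (aux j i hij hj hi g₂ g₁ h₂ h₁).symm

/-- The product of a word in elements satisfying the Coxeter relations of the symmetric group
depends only on the permutation that the word represents. -/
theorem reduced_word (hquad : ∀ i, S i * S i = 1)
    (hbraid : ∀ i j : Fin (N - 1), j.1 = i.1 + 1 → S i * S j * S i = S j * S i * S j)
    (hcomm : ∀ i j : Fin (N - 1), i.1 + 1 < j.1 → S i * S j = S j * S i)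
    (l : List (Fin (N - 1))) : Reduced S (l.map simpleRefl).prod (l.map S).prod := by
  induction l using List.reverseRecOn with
  | nil => exact Reduced.one
  | append_singleton l i ih =>
    simp only [List.map_append, List.prod_append, List.map_cons, List.map_nil, List.prod_cons,
      List.prod_nil, mul_one]
    set w := (l.map simpleRefl).prod
    rcases lt_or_gt_of_ne (w.injective.ne (lo_lt_hi i).ne) with h | h
    · exact Reduced.step i h ih
    · obtain ⟨g, hg⟩ := exists_reduced S (w * simpleRefl i)
      rw [ih.unique hbraid hcomm (Reduced.of_descent h hg), mul_assoc, hquad, mul_one]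
      exact hg

theorem prod_map_eq_of_prod_map_eq (hquad : ∀ i, S i * S i = 1)
    (hbraid : ∀ i j : Fin (N - 1), j.1 = i.1 + 1 → S i * S j * S i = S j * S i * S j)
    (hcomm : ∀ i j : Fin (N - 1), i.1 + 1 < j.1 → S i * S j = S j * S i)
    {l m : List (Fin (N - 1))} (h : (l.map simpleRefl).prod = (m.map simpleRefl).prod) :
    (l.map S).prod = (m.map S).prod :=
  (reduced_word hquad hbraid hcomm l).unique hbraid hcomm
    (h ▸ reduced_word hquad hbraid hcomm m)

end Coxeter

/-! ### Young's seminormal form -/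

/-- The diagonal coefficient `1 / (x - y)` of Young's seminormal form, in terms of the contents
`x`, `y` of two consecutive entries. -/
def diagCoeff (x y : ℤ) : ℚ := 1 / ((x : ℚ) - (y : ℚ))

/-- The off-diagonal coefficient of Young's seminormal form. It vanishes for `|x - y| = 1`, that is
when the two entries cannot be interchanged. -/
def offCoeff (x y : ℤ) : ℚ :=
  if x = y + 1 then 0 else if y < x then 1 else 1 - diagCoeff x y ^ 2

theorem diagCoeff_swap (x y : ℤ) : diagCoeff y x = -diagCoeff x y := by
  unfold diagCoeff
  rw [← neg_sub, one_div, one_div, inv_neg]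

theorem offCoeff_mul_offCoeff {x y : ℤ} (h : x ≠ y) :
    offCoeff x y * offCoeff y x = 1 - diagCoeff x y ^ 2 := by
  have key : ∀ x y : ℤ, y < x → offCoeff x y * offCoeff y x = 1 - diagCoeff x y ^ 2 := by
    intro x y h
    unfold offCoeff
    rw [if_pos h, if_neg (show ¬ y = x + 1 by omega), if_neg (show ¬ x < y by omega),
      diagCoeff_swap x y]
    split_ifs with h1
    · subst h1
      simp [diagCoeff]
    · ring
  rcases lt_or_gt_of_ne h with h | h
  · rw [mul_comm, key _ _ h, diagCoeff_swap x y]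
    ring
  · exact key _ _ h

/-- The identity behind the braid relation. -/
theorem diagCoeff_mul_diagCoeff {x y z : ℤ} (hxy : x ≠ y) (hyz : y ≠ z) (hxz : x ≠ z) :
    diagCoeff x y * diagCoeff y z = diagCoeff x z * (diagCoeff x y + diagCoeff y z) := by
  have h1 : (x : ℚ) - y ≠ 0 := sub_ne_zero.mpr (by exact_mod_cast hxy)
  have h2 : (y : ℚ) - z ≠ 0 := sub_ne_zero.mpr (by exact_mod_cast hyz)
  have h3 : (x : ℚ) - z ≠ 0 := sub_ne_zero.mpr (by exact_mod_cast hxz)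
  unfold diagCoeff
  field_simp
  ring

section Fillings

variable {I X K : Type*} [DecidableEq I] [Field K] (c : X → ℤ)

/-- Young's seminormal operator for the transposition of two positions, on the space spanned by all
fillings `σ` of a set `X` of nodes with contents `c`, standard or not. -/
def fillOp (i j : I) : Module.End K ((I ≃ X) →₀ K) :=
  Finsupp.linearCombination K fun σ =>
    (diagCoeff (c (σ i)) (c (σ j)) : K) • Finsupp.single σ (1 : K) +
      (offCoeff (c (σ i)) (c (σ j)) : K) • Finsupp.single ((Equiv.swap i j).trans σ) (1 : K)

theorem fillOp_single (i j : I) (σ : I ≃ X) : fillOp c i j (Finsupp.single σ (1 : K)) =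
    (diagCoeff (c (σ i)) (c (σ j)) : K) • Finsupp.single σ (1 : K) +
      (offCoeff (c (σ i)) (c (σ j)) : K) • Finsupp.single ((Equiv.swap i j).trans σ) (1 : K) := by
  simp [fillOp]

theorem fillOp_fillOp [CharZero K] {i j : I} {σ : I ≃ X} (h : c (σ i) ≠ c (σ j)) :
    fillOp c i j (fillOp c i j (Finsupp.single σ (1 : K))) = Finsupp.single σ (1 : K) := by
  have e : (Equiv.swap i j).trans ((Equiv.swap i j).trans σ) = σ := by
    ext k; simp
  have h1 : (offCoeff (c (σ i)) (c (σ j)) * offCoeff (c (σ j)) (c (σ i)) : K) =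
      1 - (diagCoeff (c (σ i)) (c (σ j)) : K) ^ 2 := by
    exact_mod_cast congrArg (Rat.cast : ℚ → K) (offCoeff_mul_offCoeff h)
  have h2 : (diagCoeff (c (σ j)) (c (σ i)) : K) = -diagCoeff (c (σ i)) (c (σ j)) := by
    exact_mod_cast congrArg (Rat.cast : ℚ → K) (diagCoeff_swap _ _)
  simp only [fillOp_single, map_add, map_smul, Equiv.trans_apply, Equiv.swap_apply_left,
    Equiv.swap_apply_right, e, h2]
  linear_combination (norm := module) h1 • (Finsupp.single σ (1 : K))

theorem fillOp_comm {i j k l : I} (h1 : i ≠ k) (h2 : i ≠ l) (h3 : j ≠ k) (h4 : j ≠ l)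
    (σ : I ≃ X) :
    fillOp c i j (fillOp c k l (Finsupp.single σ (1 : K))) =
      fillOp c k l (fillOp c i j (Finsupp.single σ (1 : K))) := by
  have e : (Equiv.swap i j).trans ((Equiv.swap k l).trans σ) =
      (Equiv.swap k l).trans ((Equiv.swap i j).trans σ) := by
    have hd : Equiv.swap i j * Equiv.swap k l = Equiv.swap k l * Equiv.swap i j := by
      refine (Equiv.Perm.Disjoint.commute fun m => ?_).eq
      by_cases hm : m = i ∨ m = j
      · right
        rcases hm with rfl | rfl
        exacts [Equiv.swap_apply_of_ne_of_ne h1 h2, Equiv.swap_apply_of_ne_of_ne h3 h4]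
      · push Not at hm
        exact Or.inl (Equiv.swap_apply_of_ne_of_ne hm.1 hm.2)
    ext m
    exact congrArg (fun p : Equiv.Perm I => σ (p m)) hd.symm
  simp only [fillOp_single, map_add, map_smul, Equiv.trans_apply,
    Equiv.swap_apply_of_ne_of_ne h1 h2, Equiv.swap_apply_of_ne_of_ne h3 h4,
    Equiv.swap_apply_of_ne_of_ne h1.symm h3.symm, Equiv.swap_apply_of_ne_of_ne h2.symm h4.symm, e]
  module

theorem fillOp_braid [CharZero K] {i j k : I} (hij : i ≠ j) (hjk : j ≠ k) (hik : i ≠ k) {σ : I ≃ X}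
    (hxy : c (σ i) ≠ c (σ j)) (hyz : c (σ j) ≠ c (σ k)) (hxz : c (σ i) ≠ c (σ k)) :
    fillOp c i j (fillOp c j k (fillOp c i j (Finsupp.single σ (1 : K)))) =
      fillOp c j k (fillOp c i j (fillOp c j k (Finsupp.single σ (1 : K)))) := by
  have e1 : (Equiv.swap i j).trans ((Equiv.swap i j).trans σ) = σ := by
    ext k; simp
  have e2 : (Equiv.swap j k).trans ((Equiv.swap j k).trans σ) = σ := by
    ext k; simp
  have e3 : (Equiv.swap i j).trans ((Equiv.swap j k).trans ((Equiv.swap i j).trans σ)) =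
      (Equiv.swap j k).trans ((Equiv.swap i j).trans ((Equiv.swap j k).trans σ)) := by
    have e1 := Equiv.swap_mul_swap_mul_swap hij hik
    have e2 := Equiv.swap_mul_swap_mul_swap hjk.symm hik.symm
    rw [Equiv.swap_comm j i, Equiv.swap_comm k j, Equiv.swap_comm i k, ← e1] at e2
    ext m
    exact congrArg (fun p : Equiv.Perm I => σ (p m)) e2
  have p1 : (offCoeff (c (σ i)) (c (σ j)) * offCoeff (c (σ j)) (c (σ i)) : K) =
      1 - (diagCoeff (c (σ i)) (c (σ j)) : K) ^ 2 := by
    exact_mod_cast congrArg (Rat.cast : ℚ → K) (offCoeff_mul_offCoeff hxy)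
  have p2 : (offCoeff (c (σ j)) (c (σ k)) * offCoeff (c (σ k)) (c (σ j)) : K) =
      1 - (diagCoeff (c (σ j)) (c (σ k)) : K) ^ 2 := by
    exact_mod_cast congrArg (Rat.cast : ℚ → K) (offCoeff_mul_offCoeff hyz)
  have q1 : (diagCoeff (c (σ j)) (c (σ i)) : K) = -diagCoeff (c (σ i)) (c (σ j)) := by
    exact_mod_cast congrArg (Rat.cast : ℚ → K) (diagCoeff_swap _ _)
  have q2 : (diagCoeff (c (σ k)) (c (σ j)) : K) = -diagCoeff (c (σ j)) (c (σ k)) := by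
    exact_mod_cast congrArg (Rat.cast : ℚ → K) (diagCoeff_swap _ _)
  have key : (diagCoeff (c (σ i)) (c (σ j)) * diagCoeff (c (σ j)) (c (σ k)) : K) =
      diagCoeff (c (σ i)) (c (σ k)) *
        (diagCoeff (c (σ i)) (c (σ j)) + diagCoeff (c (σ j)) (c (σ k))) := by
    exact_mod_cast congrArg (Rat.cast : ℚ → K) (diagCoeff_mul_diagCoeff hxy hyz hxz)
  simp only [fillOp_single, map_add, map_smul, Equiv.trans_apply, Equiv.swap_apply_left,
    Equiv.swap_apply_right, Equiv.swap_apply_of_ne_of_ne hij hik,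
    Equiv.swap_apply_of_ne_of_ne hik.symm hjk.symm, e1, e2, e3, q1, q2]
  generalize (diagCoeff (c (σ i)) (c (σ j)) : K) = dxy at *
  generalize (diagCoeff (c (σ j)) (c (σ k)) : K) = dyz at *
  generalize (diagCoeff (c (σ i)) (c (σ k)) : K) = dxz at *
  generalize (offCoeff (c (σ i)) (c (σ j)) : K) = gxy at *
  generalize (offCoeff (c (σ j)) (c (σ i)) : K) = gyx at *
  generalize (offCoeff (c (σ j)) (c (σ k)) : K) = gyz at *
  generalize (offCoeff (c (σ k)) (c (σ j)) : K) = gzy at *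
  generalize (offCoeff (c (σ i)) (c (σ k)) : K) = gxz at *
  linear_combination (norm := module)
    (dxz * p1 - dxz * p2 + (dxy - dyz) * key) • (Finsupp.single σ (1 : K)) +
    (gxy * key) • (Finsupp.single ((Equiv.swap i j).trans σ) (1 : K)) -
    (gyz * key) • (Finsupp.single ((Equiv.swap j k).trans σ) (1 : K))

end Fillings

/-! ### The representation of the symmetric group on `V_τ` -/

theorem b_eq (i : Fin (N - 1)) (T : RSYT N τ) :
    b i T = diagCoeff (T.content (lo i)) (T.content (hi i)) := rfl

theorem b_pos_iff (i : Fin (N - 1)) (T : RSYT N τ) :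
    0 < b i T ↔ T.content (hi i) < T.content (lo i) := by
  rw [b, one_div, inv_pos, sub_pos, Int.cast_lt]

theorem simpleOp_v (i : Fin (N - 1)) (T : RSYT N τ) : simpleOp i (v T) = simpleVec i T := by
  simp [simpleOp, v]

/-- Young's formula in both of its cases `b > 0` and `b < 0`. -/
theorem simpleOp_v_of_cond (i : Fin (N - 1)) (T : RSYT N τ)
    (h : T.rw (lo i) ≠ T.rw (hi i) ∧ T.cm (lo i) ≠ T.cm (hi i)) :
    simpleOp i (v T) = (b i T : QK) • v T +
      (offCoeff (T.content (lo i)) (T.content (hi i)) : QK) • v (T.interchange i h) := by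
  have h2 := T.two_le_abs_content_sub i h
  have h3 : T.content (lo i) ≠ T.content (hi i) + 1 := by
    intro e
    rw [e, add_sub_cancel_left] at h2
    norm_num at h2
  rw [simpleOp_v, simpleVec, dif_pos h, offCoeff, if_neg h3]
  by_cases hb : 0 < b i T
  · rw [if_pos hb, if_pos ((b_pos_iff i T).mp hb), Rat.cast_one, one_smul]
  · rw [if_neg hb, if_neg (fun e => hb ((b_pos_iff i T).mpr e)), b_eq]

theorem simpleOp_v_of_not_cond (i : Fin (N - 1)) (T : RSYT N τ)
    (h : ¬ (T.rw (lo i) ≠ T.rw (hi i) ∧ T.cm (lo i) ≠ T.cm (hi i))) :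
    simpleOp i (v T) = (b i T : QK) • v T ∧
      offCoeff (T.content (lo i)) (T.content (hi i)) = 0 := by
  rw [simpleOp_v, simpleVec, dif_neg h, b_eq]
  by_cases hr : T.rw (lo i) = T.rw (hi i)
  · rw [if_pos hr, T.content_of_rw_eq i hr]
    simp [diagCoeff, offCoeff]
  · have hc : T.cm (lo i) = T.cm (hi i) := by
      by_contra hc
      exact h ⟨hr, hc⟩
    rw [if_neg hr, T.content_of_cm_eq i hc]
    simp [diagCoeff, offCoeff]

/-- The content of a node. -/
def cellContent (x : {c : ℕ × ℕ // c ∈ τ.cells}) : ℤ := (x.1.2 : ℤ) - (x.1.1 : ℤ)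

theorem cellContent_node (T : RSYT N τ) (i : Fin N) : cellContent (T.node i) = T.content i := rfl

/-- `V_τ` embedded into the space spanned by all fillings of the diagram. -/
def toFill : V N τ →ₗ[QK] ((Fin N ≃ {c : ℕ × ℕ // c ∈ τ.cells}) →₀ QK) :=
  Finsupp.lmapDomain QK QK RSYT.node

theorem toFill_injective : Function.Injective (toFill : V N τ →ₗ[QK] _) :=
  Finsupp.mapDomain_injective fun _ _ h => RSYT.ext h

theorem toFill_v (T : RSYT N τ) : toFill (v T) = Finsupp.single T.node 1 := by
  simp [toFill, v]

theorem V_hom_ext {W : Type*} [AddCommMonoid W] [Module QK W] {f g : V N τ →ₗ[QK] W}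
    (h : ∀ T, f (v T) = g (v T)) : f = g :=
  Finsupp.lhom_ext' fun T => LinearMap.ext_ring (h T)

theorem toFill_simpleOp (i : Fin (N - 1)) (u : V N τ) :
    toFill (simpleOp i u) = fillOp cellContent (lo i) (hi i) (toFill u) := by
  refine LinearMap.congr_fun (f := toFill ∘ₗ simpleOp i)
    (g := fillOp cellContent (lo i) (hi i) ∘ₗ toFill) (V_hom_ext fun T => ?_) u
  simp only [LinearMap.comp_apply, toFill_v, fillOp_single, cellContent_node]
  by_cases h : T.rw (lo i) ≠ T.rw (hi i) ∧ T.cm (lo i) ≠ T.cm (hi i)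
  · rw [simpleOp_v_of_cond i T h, map_add, map_smul, map_smul, toFill_v, toFill_v]
    rfl
  · obtain ⟨h1, h2⟩ := simpleOp_v_of_not_cond i T h
    rw [h1, h2, map_smul, toFill_v, Rat.cast_zero, zero_smul, add_zero]
    rfl

theorem simpleOp_mul_self (i : Fin (N - 1)) :
    (simpleOp i * simpleOp i : Module.End QK (V N τ)) = 1 := by
  refine V_hom_ext fun T => toFill_injective ?_
  simp only [Module.End.mul_apply, toFill_simpleOp, Module.End.one_apply, toFill_v]
  exact fillOp_fillOp _ (T.content_lo_ne_content_hi i)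

theorem simpleOp_comm {i j : Fin (N - 1)} (h : i.1 + 1 < j.1) :
    (simpleOp i * simpleOp j : Module.End QK (V N τ)) = simpleOp j * simpleOp i := by
  refine V_hom_ext fun T => toFill_injective ?_
  simp only [Module.End.mul_apply, toFill_simpleOp, toFill_v]
  apply fillOp_comm <;> simp only [lo, hi, ne_eq, Fin.mk.injEq] <;> omega

theorem simpleOp_braid {i j : Fin (N - 1)} (h : j.1 = i.1 + 1) :
    (simpleOp i * simpleOp j * simpleOp i : Module.End QK (V N τ)) =
      simpleOp j * simpleOp i * simpleOp j := by
  refine V_hom_ext fun T => toFill_injective ?_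
  have e : lo j = hi i := Fin.ext h
  have h1 := lo_lt_hi i
  have h2 : hi i < hi j := e ▸ lo_lt_hi j
  simp only [Module.End.mul_apply, toFill_simpleOp, toFill_v, e]
  apply fillOp_braid _ h1.ne h2.ne (h1.trans h2).ne
  · exact T.content_lo_ne_content_hi i
  · exact e ▸ T.content_lo_ne_content_hi j
  · exact T.content_ne (h1.trans h2) (by simp only [lo, hi]; omega)

theorem map_word (w : Equiv.Perm (Fin N)) : ((word w).map simpleRefl).prod = w :=
  (exists_word w).choose_spec

/-- Any word for `w` computes the action of `w`. -/
theorem act_prod (l : List (Fin (N - 1))) :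
    (act (l.map simpleRefl).prod : Module.End QK (V N τ)) = (l.map simpleOp).prod :=
  prod_map_eq_of_prod_map_eq simpleOp_mul_self (fun _ _ => simpleOp_braid)
    (fun _ _ => simpleOp_comm) (map_word _)

theorem act_simpleRefl (i : Fin (N - 1)) :
    (act (simpleRefl i) : Module.End QK (V N τ)) = simpleOp i := by
  simpa using act_prod (τ := τ) [i]

theorem act_one : (act 1 : Module.End QK (V N τ)) = 1 := by
  simpa using act_prod (N := N) (τ := τ) []

theorem act_mul (w w' : Equiv.Perm (Fin N)) :
    (act (w * w') : Module.End QK (V N τ)) = act w * act w' := by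
  have := act_prod (τ := τ) (word w ++ word w')
  rwa [List.map_append, List.prod_append, map_word, map_word, List.map_append,
    List.prod_append] at this

/-! ### Invariance of the form on `V_τ` -/

/-- The factor of the squared norm of `v_T` belonging to contents `x`, `y` of two entries. -/
def normFactor (x y : ℤ) : ℚ :=
  if x ≤ y - 2 then (((x : ℚ) - (y : ℚ)) ^ 2 - 1) / ((x : ℚ) - (y : ℚ)) ^ 2 else 1

theorem normSq_eq (T : RSYT N τ) : normSq T =
    ∏ p : Fin N × Fin N with p.1 < p.2, normFactor (T.content p.1) (T.content p.2) := by
  unfold normSq normFactor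
  rw [← Finset.prod_filter, Finset.filter_filter]

/-- Interchanging `i` and `i + 1` permutes the pairs of entries `p < q` other than `(i, i + 1)`, so
only the factor of that pair changes. -/
theorem normSq_interchange (T : RSYT N τ) (i : Fin (N - 1)) (h) :
    normSq (T.interchange i h) * normFactor (T.content (lo i)) (T.content (hi i)) =
      normSq T * normFactor (T.content (hi i)) (T.content (lo i)) := by
  classical
  have hmem : (lo i, hi i) ∈ Finset.univ.filter (fun p : Fin N × Fin N => p.1 < p.2) := by
    simpa using lo_lt_hi i
  have hmaps : ∀ p ∈ (Finset.univ.filter (fun p : Fin N × Fin N => p.1 < p.2)).erase (lo i, hi i),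
      (simpleRefl i p.1, simpleRefl i p.2) ∈
        (Finset.univ.filter (fun p : Fin N × Fin N => p.1 < p.2)).erase (lo i, hi i) := by
    rintro ⟨p, q⟩ hp
    simp only [Finset.mem_erase, Finset.mem_filter, Finset.mem_univ, true_and, ne_eq,
      Prod.mk.injEq] at hp ⊢
    have hinv : ∀ k, simpleRefl i (simpleRefl i k) = k := fun k => Equiv.swap_apply_self _ _ k
    refine ⟨fun e => ?_, simpleRefl_lt i _ _ (by rw [hinv, hinv]; exact hp.2)
      (by rw [hinv, hinv]; exact hp.1)⟩
    have e1 : p = hi i := by rw [← hinv p, e.1, simpleRefl_lo]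
    have e2 : q = lo i := by rw [← hinv q, e.2, simpleRefl_hi]
    rw [e1, e2] at hp
    exact absurd (lo_lt_hi i) hp.2.not_gt
  rw [normSq_eq, normSq_eq, ← Finset.mul_prod_erase _ _ hmem, ← Finset.mul_prod_erase _ _ hmem]
  have hrest : ∏ p ∈ (Finset.univ.filter (fun p : Fin N × Fin N => p.1 < p.2)).erase (lo i, hi i),
      normFactor ((T.interchange i h).content p.1) ((T.interchange i h).content p.2) =
      ∏ p ∈ (Finset.univ.filter (fun p : Fin N × Fin N => p.1 < p.2)).erase (lo i, hi i),
        normFactor (T.content p.1) (T.content p.2) :=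
    Finset.prod_nbij' (fun p => (simpleRefl i p.1, simpleRefl i p.2))
      (fun p => (simpleRefl i p.1, simpleRefl i p.2)) hmaps hmaps
      (fun p _ => Prod.ext (Equiv.swap_apply_self _ _ _) (Equiv.swap_apply_self _ _ _))
      (fun p _ => Prod.ext (Equiv.swap_apply_self _ _ _) (Equiv.swap_apply_self _ _ _))
      (fun p _ => rfl)
  rw [hrest]
  simp only [RSYT.content_interchange, simpleRefl_lo, simpleRefl_hi]
  ring

/-- Where an interchange is possible, the norm factor is the off-diagonal coefficient of the
seminormal form. -/
theorem normFactor_eq_offCoeff {x y : ℤ} (h : 2 ≤ |x - y|) : normFactor x y = offCoeff x y := by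
  have h1 : x ≠ y + 1 := by
    rintro rfl
    rw [add_sub_cancel_left] at h
    norm_num at h
  have h2 : x ≠ y := by
    rintro rfl
    simp at h
  have h3 : (x : ℚ) - y ≠ 0 := sub_ne_zero.mpr (by exact_mod_cast h2)
  unfold normFactor offCoeff diagCoeff
  rw [if_neg h1]
  rw [le_abs] at h
  by_cases hlt : y < x
  · rw [if_pos hlt, if_neg (by omega)]
  · rw [if_neg hlt, if_pos (by omega)]
    field_simp

/-- The relation between the norms of `v_T` and `v_{s_i T}` that makes `s_i` self-adjoint. -/
theorem offCoeff_mul_normSq (T : RSYT N τ) (i : Fin (N - 1))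
    (h : T.rw (lo i) ≠ T.rw (hi i) ∧ T.cm (lo i) ≠ T.cm (hi i)) :
    offCoeff (T.content (lo i)) (T.content (hi i)) * normSq (T.interchange i h) =
      offCoeff (T.content (hi i)) (T.content (lo i)) * normSq T := by
  have h2 := T.two_le_abs_content_sub i h
  rw [← normFactor_eq_offCoeff h2, ← normFactor_eq_offCoeff (by rwa [abs_sub_comm]), mul_comm,
    normSq_interchange, mul_comm]

open Classical in
theorem form0_v (T T' : RSYT N τ) :
    form0 (v T) (v T') = if T = T' then (normSq T : QK) else 0 := by
  simp only [form0, v, Finsupp.linearCombination_single, one_smul, LinearMap.smul_apply,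
    Finsupp.lapply_apply, Finsupp.single_apply, smul_eq_mul, mul_ite, mul_one, mul_zero]
  exact if_congr eq_comm rfl rfl

theorem form0_simpleOp (i : Fin (N - 1)) (u u' : V N τ) :
    form0 (simpleOp i u) u' = form0 u (simpleOp i u') := by
  refine LinearMap.congr_fun (f := form0 (simpleOp i u)) (g := form0 u ∘ₗ simpleOp i)
    (V_hom_ext fun T' => ?_) u'
  refine LinearMap.congr_fun (f := form0.flip (v T') ∘ₗ simpleOp i)
    (g := form0.flip (simpleOp i (v T'))) (V_hom_ext fun T => ?_) u
  simp only [LinearMap.comp_apply, LinearMap.flip_apply]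
  have aux : ∀ S S' : RSYT N τ, ¬ (S.rw (lo i) ≠ S.rw (hi i) ∧ S.cm (lo i) ≠ S.cm (hi i)) →
      S ≠ S' → form0 (simpleOp i (v S)) (v S') = 0 ∧ form0 (v S') (simpleOp i (v S)) = 0 := by
    intro S S' hS hne
    rw [(simpleOp_v_of_not_cond i S hS).1, map_smul, map_smul, LinearMap.smul_apply, form0_v,
      form0_v, if_neg hne, if_neg hne.symm, smul_zero]
    exact ⟨rfl, rfl⟩
  by_cases hTT : T = T'
  · subst hTT
    by_cases h : T.rw (lo i) ≠ T.rw (hi i) ∧ T.cm (lo i) ≠ T.cm (hi i)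
    · simp only [simpleOp_v_of_cond i T h, map_add, map_smul, LinearMap.add_apply,
        LinearMap.smul_apply, form0_v, if_neg (T.interchange_ne i h),
        if_neg (T.interchange_ne i h).symm]
    · simp only [(simpleOp_v_of_not_cond i T h).1, map_smul, LinearMap.smul_apply]
  by_cases h : T.rw (lo i) ≠ T.rw (hi i) ∧ T.cm (lo i) ≠ T.cm (hi i)
  · by_cases h' : T'.rw (lo i) ≠ T'.rw (hi i) ∧ T'.cm (lo i) ≠ T'.cm (hi i)
    · simp only [simpleOp_v_of_cond i T h, simpleOp_v_of_cond i T' h', map_add, map_smul,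
        LinearMap.add_apply, LinearMap.smul_apply, form0_v, if_neg hTT, smul_zero, zero_add]
      by_cases e : T.interchange i h = T'
      · subst e
        have e2 := T.interchange_interchange i h h'
        rw [if_pos rfl, if_pos e2.symm]
        simp only [RSYT.content_interchange, simpleRefl_lo, simpleRefl_hi, smul_eq_mul]
        exact_mod_cast congrArg (Rat.cast : ℚ → QK) (offCoeff_mul_normSq T i h)
      · have e2 : T ≠ T'.interchange i h' := by
          rintro rfl
          exact e (T'.interchange_interchange i h' h)
        rw [if_neg e, if_neg e2, smul_zero, smul_zero]
    · rw [(aux T' T h' (Ne.symm hTT)).2, simpleOp_v_of_cond i T h]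
      have e : T.interchange i h ≠ T' := by
        rintro rfl
        exact h' (T.interchange_cond i h)
      simp [form0_v, hTT, e]
  · rw [(aux T T' h hTT).1]
    by_cases h' : T'.rw (lo i) ≠ T'.rw (hi i) ∧ T'.cm (lo i) ≠ T'.cm (hi i)
    · rw [simpleOp_v_of_cond i T' h']
      have e : T ≠ T'.interchange i h' := by
        rintro rfl
        exact h (T'.interchange_cond i h')
      simp [form0_v, hTT, e]
    · exact (aux T' T h' (Ne.symm hTT)).2.symm

theorem form0_act_act (w : Equiv.Perm (Fin N)) (u u' : V N τ) :
    form0 (act w u) (act w u') = form0 u u' := by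
  unfold act
  induction word w with
  | nil => rfl
  | cons i l ih =>
    simp only [List.map_cons, List.prod_cons, Module.End.mul_apply]
    rw [form0_simpleOp, ← Module.End.mul_apply, simpleOp_mul_self, Module.End.one_apply, ih]

/-! ### Commutation relations of the Dunkl operators -/

theorem actM_one : (actM 1 : Module.End QK (M N τ)) = 1 := by
  refine TensorProduct.ext' fun p u => ?_
  simp [actM, act_one]

theorem actM_mul (w w' : Equiv.Perm (Fin N)) :
    (actM (w * w') : Module.End QK (M N τ)) = actM w * actM w' := by
  refine TensorProduct.ext' fun p u => ?_
  simp [actM, act_mul, MvPolynomial.rename_rename]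

theorem mulX_tmul (i : Fin N) (p : Poly N) (u : V N τ) :
    mulX i (p ⊗ₜ[QK] u) = (MvPolynomial.X i * p) ⊗ₜ[QK] u := rfl

theorem actM_tmul (w : Equiv.Perm (Fin N)) (p : Poly N) (u : V N τ) :
    actM w (p ⊗ₜ[QK] u) = MvPolynomial.rename w p ⊗ₜ[QK] act w u := rfl

theorem actM_mulX (w : Equiv.Perm (Fin N)) (k : Fin N) (f : M N τ) :
    actM w (mulX k f) = mulX (w k) (actM w f) := by
  refine LinearMap.congr_fun (f := actM w * mulX k) (g := mulX (w k) * actM w)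
    (TensorProduct.ext' fun p u => ?_) f
  simp [mulX_tmul, actM_tmul]

/-- `M(τ)` is generated by the constants under the multiplications by the variables. -/
theorem M_induction {P : M N τ → Prop} (f : M N τ) (hconst : ∀ u : V N τ, P (1 ⊗ₜ[QK] u))
    (hadd : ∀ f g, P f → P g → P (f + g)) (hmul : ∀ i f, P f → P (mulX i f)) : P f := by
  induction f using TensorProduct.induction_on with
  | zero => simpa using hconst 0
  | add f g hf hg => exact hadd f g hf hg
  | tmul p u =>
    induction p using MvPolynomial.induction_on with
    | C a =>
      have e : (MvPolynomial.C a : Poly N) = a • (1 : Poly N) := by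
        rw [MvPolynomial.smul_eq_C_mul, mul_one]
      rw [e, TensorProduct.smul_tmul]
      exact hconst _
    | add p q hp hq =>
      rw [TensorProduct.add_tmul]
      exact hadd _ _ hp hq
    | mul_X p k hp =>
      rw [mul_comm, ← mulX_tmul]
      exact hmul k _ hp

theorem dividedDiff_X_mul {i j : Fin N} (h : i ≠ j) (k : Fin N) (p : Poly N) :
    dividedDiff i j (MvPolynomial.X k * p) = MvPolynomial.X k * dividedDiff i j p +
      (if k = i then (1 : QK) else if k = j then -1 else 0) •
        MvPolynomial.rename (Equiv.swap i j) p := by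
  apply mul_left_cancel₀ (X_sub_X_ne_zero h)
  change (_ - _) * ddFun i j _ = (_ - _) * (_ * ddFun i j p + _)
  rw [ddFun_spec h, mul_add, mul_left_comm, ddFun_spec h, map_mul, MvPolynomial.rename_X]
  split_ifs with h1 h2
  · subst h1
    rw [Equiv.swap_apply_left, one_smul]
    ring
  · subst h2
    rw [Equiv.swap_apply_right, neg_smul, one_smul]
    ring
  · rw [Equiv.swap_apply_of_ne_of_ne h1 h2, zero_smul]
    ring

theorem dividedDiff_one (i j : Fin N) : dividedDiff i j (1 : Poly N) = 0 := by
  by_cases h : i = j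
  · simp [dividedDiff, ddFun, h]
  · apply mul_left_cancel₀ (X_sub_X_ne_zero h)
    change (_ - _) * ddFun i j _ = _
    rw [ddFun_spec h, map_one, sub_self, mul_zero]

open Classical in
theorem dunkl_tmul (i : Fin N) (p : Poly N) (u : V N τ) :
    dunkl i (p ⊗ₜ[QK] u) = MvPolynomial.pderiv i p ⊗ₜ[QK] u +
      kappa • ∑ j : Fin N with j ≠ i, dividedDiff i j p ⊗ₜ[QK] act (Equiv.swap i j) u := by
  simp [dunkl]

theorem dunkl_const (i : Fin N) (u : V N τ) : dunkl i ((1 : Poly N) ⊗ₜ[QK] u) = 0 := by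
  simp [dunkl_tmul, dividedDiff_one]

open Classical in
/-- The commutator of the Dunkl operator `D_i` and the multiplication by `x_k`. -/
def commDX (i k : Fin N) : Module.End QK (M N τ) :=
  if k = i then 1 + kappa • ∑ j : Fin N with j ≠ i, actM (Equiv.swap i j)
  else -(kappa • actM (Equiv.swap i k))

open Classical in
theorem commDX_self_apply (i : Fin N) (f : M N τ) :
    commDX i i f = f + kappa • ∑ j : Fin N with j ≠ i, actM (Equiv.swap i j) f := by
  simp [commDX]

theorem commDX_apply_of_ne {i k : Fin N} (h : k ≠ i) (f : M N τ) :
    commDX i k f = -(kappa • actM (Equiv.swap i k) f) := by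
  simp [commDX, h]

/-- The Leibniz rule for the derivative and for the divided differences gives the commutator of
`D_i` and `x_k`. -/
theorem dunkl_mulX (i k : Fin N) (f : M N τ) :
    dunkl i (mulX k f) = mulX k (dunkl i f) + commDX i k f := by
  classical
  refine LinearMap.congr_fun (f := dunkl i * mulX k) (g := mulX k * dunkl i + commDX i k)
    (TensorProduct.ext' fun p u => ?_) f
  simp only [Module.End.mul_apply, LinearMap.add_apply, mulX_tmul, dunkl_tmul, map_add, map_smul,
    map_sum]
  have hsum : ∑ j : Fin N with j ≠ i,
      dividedDiff i j (MvPolynomial.X k * p) ⊗ₜ[QK] act (Equiv.swap i j) u =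
      ∑ j : Fin N with j ≠ i,
        (MvPolynomial.X k * dividedDiff i j p) ⊗ₜ[QK] act (Equiv.swap i j) u +
      ∑ j : Fin N with j ≠ i, (if k = i then (1 : QK) else if k = j then -1 else 0) •
        actM (Equiv.swap i j) (p ⊗ₜ[QK] u) := by
    rw [← Finset.sum_add_distrib]
    refine Finset.sum_congr rfl fun j hj => ?_
    rw [dividedDiff_X_mul (Finset.mem_filter.mp hj).2.symm, TensorProduct.add_tmul, actM_tmul,
      TensorProduct.smul_tmul']
  rw [hsum, Derivation.leibniz, smul_eq_mul, smul_eq_mul, TensorProduct.add_tmul, smul_add,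
    MvPolynomial.pderiv_X]
  by_cases hk : k = i
  · subst hk
    rw [commDX_self_apply]
    simp only [if_true, one_smul, Pi.single_eq_same, mul_one]
    abel
  · rw [commDX_apply_of_ne hk]
    have hsum2 : ∑ j : Fin N with j ≠ i, (if k = i then (1 : QK) else if k = j then -1 else 0) •
        actM (Equiv.swap i j) (p ⊗ₜ[QK] u) = -actM (Equiv.swap i k) (p ⊗ₜ[QK] u) := by
      rw [Finset.sum_eq_single_of_mem k (by simpa using hk)]
      · rw [if_neg hk, if_pos rfl]
        exact neg_one_smul QK (actM (Equiv.swap i k) (p ⊗ₜ[QK] u))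
      · intro j _ hj
        rw [if_neg hk, if_neg hj.symm, zero_smul]
    rw [hsum2, Pi.single_eq_of_ne hk, mul_zero, TensorProduct.zero_tmul, add_zero, smul_neg]
    abel

theorem actM_actM_swap (w : Equiv.Perm (Fin N)) (i j : Fin N) (f : M N τ) :
    actM w (actM (Equiv.swap i j) f) = actM (Equiv.swap (w i) (w j)) (actM w f) := by
  rw [← Module.End.mul_apply, ← Module.End.mul_apply, ← actM_mul, ← actM_mul,
    Equiv.mul_swap_eq_swap_mul]

theorem actM_commDX (w : Equiv.Perm (Fin N)) (i k : Fin N) (f : M N τ) :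
    actM w (commDX i k f) = commDX (w i) (w k) (actM w f) := by
  classical
  by_cases h : k = i
  · subst h
    rw [commDX_self_apply, commDX_self_apply, map_add, map_smul, map_sum]
    congr 2
    refine Finset.sum_equiv w (fun j => by simp) fun j _ => ?_
    rw [actM_actM_swap]
  · rw [commDX_apply_of_ne h, commDX_apply_of_ne (w.injective.ne h), map_neg, map_smul,
      actM_actM_swap]

/-- The Dunkl operators are permuted by the symmetric group. -/
theorem actM_dunkl (w : Equiv.Perm (Fin N)) (i : Fin N) (f : M N τ) :
    actM w (dunkl i f) = dunkl (w i) (actM w f) := by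
  induction f using M_induction with
  | hconst u => rw [actM_tmul, map_one, dunkl_const, dunkl_const, map_zero]
  | hadd f g hf hg => simp only [map_add, hf, hg]
  | hmul k f hf => rw [dunkl_mulX, map_add, actM_mulX, actM_mulX, dunkl_mulX, hf, actM_commDX]

theorem actM_swap_dunkl_left (i j : Fin N) (f : M N τ) :
    actM (Equiv.swap i j) (dunkl i f) = dunkl j (actM (Equiv.swap i j) f) := by
  rw [actM_dunkl, Equiv.swap_apply_left]

theorem actM_swap_dunkl_right (i j : Fin N) (f : M N τ) :
    actM (Equiv.swap i j) (dunkl j f) = dunkl i (actM (Equiv.swap i j) f) := by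
  rw [actM_dunkl, Equiv.swap_apply_right]

theorem actM_swap_dunkl_of_ne {i j k : Fin N} (h1 : k ≠ i) (h2 : k ≠ j) (f : M N τ) :
    actM (Equiv.swap i j) (dunkl k f) = dunkl k (actM (Equiv.swap i j) f) := by
  rw [actM_dunkl, Equiv.swap_apply_of_ne_of_ne h1 h2]

/-- `[[D_i, D_j], x_i] = 0`, expressed by the Jacobi identity through the commutators of Dunkl
operators and variables. -/
theorem commDX_dunkl_self {i j : Fin N} (h : i ≠ j) (f : M N τ) :
    commDX i i (dunkl j f) + dunkl i (commDX j i f) =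
      commDX j i (dunkl i f) + dunkl j (commDX i i f) := by
  classical
  have hmem : j ∈ Finset.univ.filter (fun l : Fin N => l ≠ i) := by simpa using h.symm
  rw [commDX_self_apply, commDX_self_apply, commDX_apply_of_ne h, commDX_apply_of_ne h,
    ← Finset.add_sum_erase _ _ hmem, ← Finset.add_sum_erase _ _ hmem]
  have hrest : ∑ l ∈ (Finset.univ.filter (fun l : Fin N => l ≠ i)).erase j,
      actM (Equiv.swap i l) (dunkl j f) =
      dunkl j (∑ l ∈ (Finset.univ.filter (fun l : Fin N => l ≠ i)).erase j,
        actM (Equiv.swap i l) f) := by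
    rw [map_sum]
    refine Finset.sum_congr rfl fun l hl => ?_
    exact actM_swap_dunkl_of_ne h.symm (Finset.ne_of_mem_erase hl).symm f
  rw [hrest, Equiv.swap_comm j i, actM_swap_dunkl_right, actM_swap_dunkl_left]
  simp only [map_add, map_smul, map_neg, smul_add]
  abel

/-- `[[D_i, D_j], x_k] = 0` for `k ≠ i, j`, expressed in the same way. -/
theorem commDX_dunkl_of_ne {i j k : Fin N} (hki : k ≠ i) (hkj : k ≠ j) (hij : i ≠ j)
    (f : M N τ) :
    commDX i k (dunkl j f) + dunkl i (commDX j k f) =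
      commDX j k (dunkl i f) + dunkl j (commDX i k f) := by
  simp only [commDX_apply_of_ne hki, commDX_apply_of_ne hkj, map_smul, map_neg,
    actM_swap_dunkl_of_ne hij.symm hkj.symm, actM_swap_dunkl_of_ne hij hki.symm]
  abel

/-- The commutator of `D_i` and `D_j` commutes with every `x_k`, by the Jacobi identity, and kills
the constants. -/
theorem dunkl_comm (i j : Fin N) (f : M N τ) : dunkl i (dunkl j f) = dunkl j (dunkl i f) := by
  by_cases hij : i = j
  · rw [hij]
  induction f using M_induction with
  | hconst u => rw [dunkl_const, dunkl_const, map_zero, map_zero]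
  | hadd f g hf hg => simp only [map_add, hf, hg]
  | hmul k f hf =>
    rw [dunkl_mulX, dunkl_mulX, map_add, map_add, dunkl_mulX, dunkl_mulX, hf, add_assoc, add_assoc]
    congr 1
    by_cases hki : k = i
    · subst hki
      exact commDX_dunkl_self hij f
    by_cases hkj : k = j
    · subst hkj
      exact (commDX_dunkl_self (Ne.symm hij) f).symm
    exact commDX_dunkl_of_ne hki hkj hij f

/-! ### The contravariant form -/

theorem list_prod_pow_add_single {A ι : Type*} [Monoid A] [DecidableEq ι] (a : ι → A)
    (hcomm : ∀ i j, Commute (a i) (a j)) (α : ι →₀ ℕ) (i : ι) (l : List ι) (hl : l.Nodup) :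
    (l.map fun j => a j ^ (α + Finsupp.single i 1 : ι →₀ ℕ) j).prod =
      (l.map fun j => a j ^ α j).prod * (if i ∈ l then a i else 1) := by
  induction l with
  | nil => simp
  | cons j l ih =>
    rw [List.nodup_cons] at hl
    rw [List.map_cons, List.prod_cons, List.map_cons, List.prod_cons, ih hl.2]
    by_cases h : i = j
    · subst h
      have hc : Commute (a i) (l.map fun j => a j ^ α j).prod := by
        refine Commute.list_prod_right _ _ fun x hx => ?_
        obtain ⟨k, -, rfl⟩ := List.mem_map.mp hx
        exact (hcomm i k).pow_right _
      simp only [Finsupp.add_apply, Finsupp.single_eq_same, pow_succ, if_neg hl.1, mul_one,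
        List.mem_cons, true_or, if_true, mul_assoc, hc.eq]
    · simp [h, mul_assoc]

theorem dunklMono_add_single (α : Fin N →₀ ℕ) (i : Fin N) :
    (dunklMono ⇑(α + Finsupp.single i 1 : Fin N →₀ ℕ) : Module.End QK (M N τ)) =
      dunklMono ⇑α * dunkl i := by
  unfold dunklMono
  rw [List.ofFn_eq_map, List.ofFn_eq_map, list_prod_pow_add_single _
    (fun i j => LinearMap.ext fun f => dunkl_comm i j f) α i _ (List.nodup_finRange N),
    if_pos (List.mem_finRange i)]

theorem polyDunkl_monomial (α : Fin N →₀ ℕ) :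
    (polyDunkl (MvPolynomial.monomial α 1) : Module.End QK (M N τ)) = dunklMono ⇑α := by
  have := (MvPolynomial.basisMonomials (Fin N) QK).constr_basis QK
    (fun α => (dunklMono (α : Fin N → ℕ) : Module.End QK (M N τ))) α
  rwa [MvPolynomial.coe_basisMonomials] at this

theorem polyDunkl_X_mul (i : Fin N) (p : Poly N) :
    (polyDunkl (MvPolynomial.X i * p) : Module.End QK (M N τ)) = polyDunkl p * dunkl i := by
  refine LinearMap.congr_fun
    (f := polyDunkl ∘ₗ LinearMap.mulLeft QK (MvPolynomial.X i : Poly N))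
    (g := LinearMap.mulRight QK (dunkl i : Module.End QK (M N τ)) ∘ₗ polyDunkl)
    ((MvPolynomial.basisMonomials (Fin N) QK).ext fun α => ?_) p
  simp only [LinearMap.comp_apply, MvPolynomial.coe_basisMonomials, LinearMap.mulLeft_apply,
    LinearMap.mulRight_apply, polyDunkl_monomial]
  rw [mul_comm, MvPolynomial.X, MvPolynomial.monomial_mul, mul_one, polyDunkl_monomial,
    dunklMono_add_single]

theorem polyDunkl_one : (polyDunkl 1 : Module.End QK (M N τ)) = 1 := by
  have := polyDunkl_monomial (N := N) (τ := τ) 0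
  rw [show (MvPolynomial.monomial (0 : Fin N →₀ ℕ) (1 : QK)) = 1 from rfl] at this
  rw [this, dunklMono, List.ofFn_eq_map]
  refine List.prod_eq_one fun x hx => ?_
  obtain ⟨k, -, rfl⟩ := List.mem_map.mp hx
  simp

theorem form_tmul (p : Poly N) (u : V N τ) (g : M N τ) :
    form (p ⊗ₜ[QK] u) g = form0 u (evalZero (polyDunkl p g)) := rfl

theorem form_mulX_left (i : Fin N) (f g : M N τ) : form (mulX i f) g = form f (dunkl i g) := by
  refine LinearMap.congr_fun (f := form.flip g ∘ₗ mulX i) (g := form.flip (dunkl i g))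
    (TensorProduct.ext' fun p u => ?_) f
  simp only [LinearMap.comp_apply, LinearMap.flip_apply, mulX_tmul, form_tmul, polyDunkl_X_mul,
    Module.End.mul_apply]

theorem form_const (u : V N τ) (g : M N τ) : form ((1 : Poly N) ⊗ₜ[QK] u) g =
    form0 u (evalZero g) := by
  rw [form_tmul, polyDunkl_one, Module.End.one_apply]

theorem evalZero_mulX (i : Fin N) (f : M N τ) : evalZero (mulX i f) = 0 := by
  refine LinearMap.congr_fun (f := evalZero ∘ₗ mulX i) (g := 0)
    (TensorProduct.ext' fun p u => ?_) f
  simp [mulX_tmul, evalZero]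

theorem evalZero_const (u : V N τ) : evalZero ((1 : Poly N) ⊗ₜ[QK] u) = u := by
  simp [evalZero]

theorem evalZero_actM (w : Equiv.Perm (Fin N)) (f : M N τ) :
    evalZero (actM w f) = act w (evalZero f) := by
  induction f using M_induction with
  | hconst u => rw [actM_tmul, map_one, evalZero_const, evalZero_const]
  | hadd f g hf hg => simp only [map_add, hf, hg]
  | hmul k f hf => rw [actM_mulX, evalZero_mulX, evalZero_mulX, map_zero]

theorem form_actM_actM (w : Equiv.Perm (Fin N)) (f g : M N τ) :
    form (actM w f) (actM w g) = form f g := by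
  induction f using M_induction generalizing g with
  | hconst u =>
    rw [actM_tmul, map_one, form_const, form_const, evalZero_actM, form0_act_act]
  | hadd f f' hf hf' => simp only [map_add, LinearMap.add_apply, hf, hf']
  | hmul k f hf => rw [actM_mulX, form_mulX_left, form_mulX_left, ← actM_dunkl, hf]

theorem form_actM_swap (i j : Fin N) (f g : M N τ) :
    form (actM (Equiv.swap i j) f) g = form f (actM (Equiv.swap i j) g) := by
  rw [← form_actM_actM (Equiv.swap i j) f, ← Module.End.mul_apply (actM _) (actM _) g, ← actM_mul,
    Equiv.swap_mul_self, actM_one, Module.End.one_apply]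

theorem form_commDX (i k : Fin N) (f g : M N τ) :
    form (commDX k i f) g = form f (commDX i k g) := by
  by_cases h : k = i
  · subst h
    simp only [commDX_self_apply, map_add, LinearMap.add_apply, map_smul, LinearMap.smul_apply,
      map_sum, LinearMap.sum_apply, form_actM_swap]
  · rw [commDX_apply_of_ne h, commDX_apply_of_ne (Ne.symm h)]
    simp only [map_neg, map_smul, LinearMap.neg_apply, LinearMap.smul_apply, form_actM_swap,
      Equiv.swap_comm k i]

/-- The adjointness of `D_k` and `x_k` in the other argument. The commutator of `D_i` and `x_k` is
adjoint to that of `D_k` and `x_i`, which carries the relation from `f` to `x_i f`. -/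
theorem form_mulX_right (k : Fin N) (f g : M N τ) : form f (mulX k g) = form (dunkl k f) g := by
  induction f using M_induction generalizing g with
  | hconst u =>
    rw [form_const, evalZero_mulX, dunkl_const, map_zero, map_zero, LinearMap.zero_apply]
  | hadd f f' hf hf' => simp only [map_add, LinearMap.add_apply, hf, hf']
  | hmul i f hf =>
    rw [form_mulX_left, dunkl_mulX, map_add, hf, dunkl_mulX, map_add, LinearMap.add_apply,
      form_mulX_left, form_commDX]

/-- The operators `U_i` are self-adjoint for the contravariant form. -/
theorem form_opU (i : Fin N) (f g : M N τ) : form (opU i f) g = form f (opU i g) := by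
  simp only [opU, LinearMap.sub_apply, Module.End.mul_apply, LinearMap.smul_apply,
    LinearMap.sum_apply, map_sub, map_smul, map_sum, form_actM_swap]
  rw [← form_mulX_right, form_mulX_left]

/-! ### Orthogonality of the nonsymmetric Jack polynomials -/

theorem opU_zeta (α : Fin N → ℕ) (T : RSYT N τ) (i : Fin N) :
    opU i (zeta α T) = xi α T i • zeta α T := by
  unfold zeta
  split_ifs with h
  · exact h.choose_spec.1 i
  -- The default value `0` in the definition of `zeta` satisfies every eigenvalue equation.
  · rw [map_zero, smul_zero]

/-- As `κ` is transcendental, both coefficients of `a + κ c` are determined by its value. -/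
theorem add_kappa_mul_injective {a a' : ℕ} {c c' : ℤ}
    (h : (a : QK) + 1 + kappa * (c : QK) = (a' : QK) + 1 + kappa * (c' : QK)) :
    a = a' ∧ c = c' := by
  have key : ∀ (a : ℕ) (c : ℤ), (a : QK) + 1 + kappa * (c : QK) =
      algebraMap (Polynomial ℚ) (RatFunc ℚ)
        ((a : Polynomial ℚ) + 1 + Polynomial.X * (c : Polynomial ℚ)) := by
    intro a c
    simp [kappa, RatFunc.algebraMap_X]
  rw [key, key] at h
  have hp := RatFunc.algebraMap_injective ℚ h
  have h0 := congrArg (Polynomial.eval 0) hp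
  have h1 := congrArg (Polynomial.eval 1) hp
  simp only [Polynomial.eval_add, Polynomial.eval_natCast, Polynomial.eval_one,
    Polynomial.eval_mul, Polynomial.eval_X, Polynomial.eval_intCast, zero_mul, one_mul, add_zero,
    add_left_inj] at h0 h1
  refine ⟨by exact_mod_cast h0, ?_⟩
  rw [h0] at h1
  exact_mod_cast add_left_cancel h1

/-- The spectral vector determines the label `(α, T)`. -/
theorem eq_of_xi_eq {α β : Fin N → ℕ} {T T' : RSYT N τ} (h : ∀ i, xi α T i = xi β T' i) :
    α = β ∧ T = T' := by
  have hα : α = β := funext fun i => (add_kappa_mul_injective (h i)).1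
  subst hα
  refine ⟨rfl, RSYT.content_injective (funext fun k => ?_)⟩
  have := (add_kappa_mul_injective (h ((rank α).symm k))).2
  rwa [Equiv.apply_symm_apply] at this

/-- Jack polynomials with different labels are eigenvectors of some `U_i` for different eigenvalues,
hence orthogonal. -/
theorem form_zeta_zeta {α β : Fin N → ℕ} {T T' : RSYT N τ} (h : ¬ (α = β ∧ T = T')) :
    form (zeta α T) (zeta β T') = 0 := by
  obtain ⟨i, hi⟩ : ∃ i, xi α T i ≠ xi β T' i := by
    by_contra! hall
    exact h (eq_of_xi_eq hall)
  have := form_opU i (zeta α T) (zeta β T')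
  rw [opU_zeta, opU_zeta, map_smul, map_smul, LinearMap.smul_apply, smul_eq_mul,
    smul_eq_mul] at this
  exact (mul_eq_zero.mp (by linear_combination this :
    (xi α T i - xi β T' i) * form (zeta α T) (zeta β T') = 0)).resolve_left (sub_ne_zero.mpr hi)

/-! ### The sets `Y(T; W_λ)` are the classes of an equivalence relation -/

/-- `T'` arises from `T` by interchanging two consecutive entries `i`, `i + 1` with
`λ_i = λ_{i+1}`. -/
def Step (lam : Fin N → ℕ) (T T' : RSYT N τ) : Prop :=
  ∃ i h, lam (lo i) = lam (hi i) ∧ T' = T.interchange i h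

theorem Step.symm {lam : Fin N → ℕ} {T T' : RSYT N τ} (h : Step lam T T') : Step lam T' T := by
  obtain ⟨i, hc, hl, rfl⟩ := h
  exact ⟨i, T.interchange_cond i hc, hl, (T.interchange_interchange i hc _).symm⟩

/-- `T'` arises from `T` by a sequence of such interchanges. -/
abbrev Reach (lam : Fin N → ℕ) : RSYT N τ → RSYT N τ → Prop :=
  Relation.ReflTransGen (Step lam)

theorem Reach.symm {lam : Fin N → ℕ} {T T' : RSYT N τ} (h : Reach lam T T') : Reach lam T' T := by
  induction h with
  | refl => exact Relation.ReflTransGen.refl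
  | tail _ hstep ih => exact Relation.ReflTransGen.head hstep.symm ih

theorem lam_apply_of_mem_stab {lam : Fin N → ℕ} {w : Equiv.Perm (Fin N)} (hw : w ∈ stab lam)
    (i : Fin N) : lam (w i) = lam i := by
  have := hw (w i)
  rw [show w⁻¹ (w i) = i from w.symm_apply_apply i] at this
  exact this.symm

theorem simpleRefl_mem_stab {lam : Fin N → ℕ} {i : Fin (N - 1)} (h : lam (lo i) = lam (hi i)) :
    simpleRefl i ∈ stab lam := by
  intro k
  rw [simpleRefl, Equiv.swap_inv, Equiv.swap_apply_def]
  split_ifs with h1 h2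
  · rw [h1, h]
  · rw [h2, h]
  · rfl

/-- For a partition `λ`, the group `W_λ` is generated by its simple reflections: a descent of
`w ∈ W_λ` lies within a block of `λ`. -/
theorem exists_word_of_mem_stab {lam : Fin N → ℕ} (hlam : Antitone lam) {w : Equiv.Perm (Fin N)}
    (hw : w ∈ stab lam) : ∃ l : List (Fin (N - 1)), (∀ i ∈ l, lam (lo i) = lam (hi i)) ∧
      (l.map simpleRefl).prod = w := by
  induction hn : potential w using Nat.strong_induction_on generalizing w with
  | _ n ih =>
    by_cases h1 : w = 1
    · exact ⟨[], by simp, by simp [h1]⟩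
    · obtain ⟨i, hi⟩ := exists_descent h1
      have heq : lam (lo i) = lam (VVJack.hi i) := by
        have e1 := hlam hi.le
        rw [lam_apply_of_mem_stab hw, lam_apply_of_mem_stab hw] at e1
        exact le_antisymm e1 (hlam (lo_lt_hi i).le)
      obtain ⟨l, hl, hprod⟩ := ih _ (hn ▸ potential_mul_lt hi)
        ((stab lam).mul_mem hw (simpleRefl_mem_stab heq)) rfl
      refine ⟨l ++ [i], fun j hj => ?_, ?_⟩
      · rcases List.mem_append.mp hj with hj | hj
        · exact hl j hj
        · rw [List.mem_singleton.mp hj, heq]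
      · rw [List.map_append, List.prod_append, hprod, List.map_singleton, List.prod_singleton,
          mul_assoc, simpleRefl_mul_self, mul_one]

/-- The span of the `v_S`, `S` in the class of `T`, is invariant under the simple reflections that
generate `W_λ`. -/
theorem reach_of_mem_Y {lam : Fin N → ℕ} (hlam : Antitone lam) {T T' : RSYT N τ}
    (h : T' ∈ Y T (stab lam)) : Reach lam T T' := by
  let K : Submodule QK (V N τ) := Finsupp.supported QK QK {S | Reach lam T S}
  have hv : ∀ S, Reach lam T S → v S ∈ K := fun S hS => Finsupp.single_mem_supported QK 1 hS
  have hK : ∀ i, lam (lo i) = lam (hi i) → ∀ u ∈ K, simpleOp i u ∈ K := by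
    intro i hi u hu
    change u ∈ Finsupp.supported QK QK {S | Reach lam T S} at hu
    rw [Finsupp.supported_eq_span_single] at hu
    refine (Submodule.span_le (p := K.comap (simpleOp i))).mpr ?_ hu
    rintro _ ⟨S, hS, rfl⟩
    change simpleOp i (v S) ∈ K
    by_cases hc : S.rw (lo i) ≠ S.rw (VVJack.hi i) ∧ S.cm (lo i) ≠ S.cm (VVJack.hi i)
    · rw [simpleOp_v_of_cond i S hc]
      exact K.add_mem (K.smul_mem _ (hv S hS))
        (K.smul_mem _ (hv _ (Relation.ReflTransGen.tail hS ⟨i, hc, hi, rfl⟩)))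
    · rw [(simpleOp_v_of_not_cond i S hc).1]
      exact K.smul_mem _ (hv S hS)
  have hle : VH T (stab lam) ≤ K := by
    refine Submodule.span_le.mpr ?_
    rintro _ ⟨w, hw, rfl⟩
    obtain ⟨l, hl, rfl⟩ := exists_word_of_mem_stab hlam hw
    rw [act_prod]
    clear hw
    induction l with
    | nil => exact hv T Relation.ReflTransGen.refl
    | cons i l ih =>
      rw [List.map_cons, List.prod_cons]
      exact hK i (hl i (by simp)) _ (ih fun j hj => hl j (by simp [hj]))
  have hmem : v T' ∈ K := hle h
  by_contra hno
  have := (Finsupp.mem_supported' QK (v T')).mp hmem T' hno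
  simp [v] at this

theorem act_mem_VH {T : RSYT N τ} {H : Subgroup (Equiv.Perm (Fin N))} {w : Equiv.Perm (Fin N)}
    (hw : w ∈ H) {u : V N τ} (hu : u ∈ VH T H) : act w u ∈ VH T H := by
  refine (Submodule.span_le (p := (VH T H).comap (act w))).mpr ?_ hu
  rintro _ ⟨w', hw', rfl⟩
  refine Submodule.subset_span ⟨w * w', H.mul_mem hw hw', ?_⟩
  rw [act_mul, Module.End.mul_apply]

theorem offCoeff_ne_zero {x y : ℤ} (h : 2 ≤ |x - y|) : offCoeff x y ≠ 0 := by
  intro h0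
  have hxy : x ≠ y := by
    rintro rfl
    simp at h
  have h1 := offCoeff_mul_offCoeff hxy
  rw [h0, zero_mul, diagCoeff, div_pow, one_pow, eq_comm, sub_eq_zero, eq_comm,
    div_eq_one_iff_eq (pow_ne_zero 2 (sub_ne_zero.mpr (by exact_mod_cast hxy)))] at h1
  have h2 : (x - y) ^ 2 = 1 := by exact_mod_cast h1.symm
  rw [← sq_abs] at h2
  nlinarith

/-- `V_T(W_λ)` contains with `v_S` also `s_i v_S`, hence `v_{s_i S}`, whose coefficient in `s_i v_S`
is not zero. -/
theorem mem_Y_of_reach {lam : Fin N → ℕ} {T T' : RSYT N τ} (h : Reach lam T T') :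
    T' ∈ Y T (stab lam) := by
  induction h with
  | refl =>
    refine Submodule.subset_span ⟨1, (stab lam).one_mem, ?_⟩
    rw [act_one, Module.End.one_apply]
  | @tail S S' _ hstep ih =>
    obtain ⟨i, hc, hl, rfl⟩ := hstep
    have h1 := act_mem_VH (simpleRefl_mem_stab hl) ih
    rw [act_simpleRefl, simpleOp_v_of_cond i S hc] at h1
    have h2 := (Submodule.add_mem_iff_right _ (Submodule.smul_mem _ _ ih)).mp h1
    exact (Submodule.smul_mem_iff _ (by
      exact_mod_cast offCoeff_ne_zero (S.two_le_abs_content_sub i hc))).mp h2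

/-- Two sets `Y(T₁; W_λ)` and `Y(T₂; W_λ)` that meet coincide. -/
theorem mem_Y_of_mem_of_mem {lam : Fin N → ℕ} (hlam : Antitone lam) {T T₁ T₂ : RSYT N τ}
    (h₁ : T ∈ Y T₁ (stab lam)) (h₂ : T ∈ Y T₂ (stab lam)) : T₂ ∈ Y T₁ (stab lam) :=
  mem_Y_of_reach ((reach_of_mem_Y hlam h₁).trans (reach_of_mem_Y hlam h₂).symm)

end VVJack

end

theorem mainTheorem8 (N : ℕ) (hN : 2 ≤ N) (τ : YoungDiagram) (hτ : τ.card = N)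
    (lam mu : Fin N → ℕ) (hlam : Antitone lam) (hmu : Antitone mu)
    (T1 T2 : VVJack.RSYT N τ)
    (h1 : VVJack.ColumnStrict (VVJack.floorTableau lam T1))
    (h2 : VVJack.ColumnStrict (VVJack.floorTableau mu T2))
    (h : lam ≠ mu ∨ T2 ∉ VVJack.Y T1 (VVJack.stab lam)) :
    VVJack.form (VVJack.fs lam T1) (VVJack.fs mu T2) = 0 := by
  classical
  simp only [VVJack.fs, map_sum, LinearMap.sum_apply, map_smul, LinearMap.smul_apply]
  refine Finset.sum_eq_zero fun β hβ => Finset.sum_eq_zero fun T' hT' => ?_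
  refine smul_eq_zero_of_right _ ?_
  refine Finset.sum_eq_zero fun α hα => Finset.sum_eq_zero fun T hT => ?_
  rw [VVJack.form_zeta_zeta, smul_zero]
  rintro ⟨rfl, rfl⟩
  rw [VVJack.above, Set.Finite.mem_toFinset] at hα hβ
  rw [Finset.mem_filter] at hT hT'
  obtain rfl : lam = mu := Eq.trans (Eq.symm hα) hβ
  exact h.elim (fun hne => hne rfl) fun hY => hY (VVJack.mem_Y_of_mem_of_mem hlam hT.2 hT'.2)
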